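/- Let $M$ be a compact connected smooth manifold without boundary and let $X^t\colon M\to M$ be a smooth flow. Let $p\colon\tilde M\to M$ be the universal abelian cover, i.e. the connected covering corresponding to the commutator subgroup of $\pi_1(M)$, with group of deck transformations $\Gamma_0\simeq H_1(M,\mathbb Z)=\pi_1(M)^{\mathrm{ab}}$, and let $\tilde X^t\colon\tilde M\to\tilde M$ be the lift of $X^t$. For $\mu\in H^1(M,\mathbb R)=\mathrm{Hom}(H_1(M,\mathbb Z),\mathbb R)$ let $$\Gamma_\mu=\{\gamma\circ\tilde X^{\mu(\gamma)}:\gamma\in\Gamma_0\},\qquad M_\mu=\tilde M/\Gamma_\mu .$$ Then there is an open neighborhood $\mathcal U$ of $0$ in $H^1(M,\mathbb R)$ such that for every $\mu\in\mathcal U$ the space $M_\mu$ has the structure of a smooth manifold for which $\tilde M\to M_\mu$ is a covering map and a local diffeomorphism, $\tilde X^t$ induces a smooth flow $X_\mu^t$ on $M_\mu$, and there are diffeomorphisms $h_\mu\colon M\to M_\mu$, $\mu\in\mathcal U$, such that $h_\mu^{-1}\circ X_\mu^t\circ h_\mu(x)$ depends continuously on $(\mu,t,x)\in\mathcal U\times\mathbb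 R\times M$ and the following hold. 1. $X_0^t=X^t$: the diffeomorphism $h_0\colon M\to M_0=\tilde M/\Gamma_0$ is the canonical identification (it sends $p(y)$ to the orbit of $y$) and $h_0\circ X^t=X_0^t\circ h_0$. 2. Each $h_\mu$, $\mu\in\mathcal U$, is an orbit equivalence between $X^t$ and $X_\mu^t$: it sends orbits onto orbits and preserves the time direction. 3. If $x\in M$ is a periodic point of $X^t$ with minimal period $\mathrm{per}_X(x)>0$ and $\gamma\in H_1(M,\mathbb Z)$ is the homology class of its orbit, then for every $\mu\in\mathcal U$ the point $h_\mu(x)$ is periodic for $X_\mu^t$ with minimal period $$\mathrm{per}_{X_\mu}(h_\mu(x))=\mathrm{per}_X(x)+\mu(\gamma).$$ 4. If $X^t$ is Anosov, then $X_\mu^t$ is Anosov for all $\mu\in\mathcal U$. 5. If $X^t$ is contact, i.e. generated by the Reeb vector field of a smooth 1-form $\beta$ with $\beta\wedge(d\beta)^k$ nowhere zero, $\dim M=2k+1$, then $X_\mu^t$ is contact for all $\mu\in\mathcal U$. -/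

import Mathlib

open scoped Manifold ContDiff Topology

noncomputable section

/-! ### First homology and cohomology of a path-connected space -/

section Homology

variable {M : Type*} [TopologicalSpace M]

/-- `H₁(M, ℤ)` of a path-connected space `M`: the abelianization of the fundamental group,
written additively. -/
abbrev FirstHomology (x₀ : M) : Type _ := Additive (Abelianization (FundamentalGroup M x₀))

/-- The class in `H₁(M, ℤ)` of a loop based at `x₀`. -/
def basedLoopClass (x₀ : M) (ℓ : Path x₀ x₀) : FirstHomology x₀ :=
  Additive.ofMul (Abelianization.of (FundamentalGroup.fromPath (Path.Homotopic.Quotient.mk ℓ)))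

/-- The class in `H₁(M, ℤ)` of a loop based at an arbitrary point `x`: the loop is moved to the
base point `x₀` along a path; in the abelianization the choice of that path is immaterial. -/
def freeLoopClass [PathConnectedSpace M] (x₀ : M) {x : M} (ℓ : Path x x) : FirstHomology x₀ :=
  Additive.ofMul (Abelianization.of
    (FundamentalGroup.fundamentalGroupMulEquivOfPath (PathConnectedSpace.somePath x x₀)
      (FundamentalGroup.fromPath (Path.Homotopic.Quotient.mk ℓ))))

/-- `H¹(M, ℝ) = Hom(H₁(M, ℤ), ℝ)`. -/
def FirstCohomology (x₀ : M) : Type _ := FirstHomology x₀ →+ ℝ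

instance (x₀ : M) : AddCommGroup (FirstCohomology x₀) :=
  inferInstanceAs (AddCommGroup (FirstHomology x₀ →+ ℝ))

instance (x₀ : M) : FunLike (FirstCohomology x₀) (FirstHomology x₀) ℝ :=
  inferInstanceAs (FunLike (FirstHomology x₀ →+ ℝ) (FirstHomology x₀) ℝ)

/-- The topology of pointwise convergence. For a compact manifold `H₁(M, ℤ)` is finitely
generated, and this is the usual topology of the finite-dimensional space `H¹(M, ℝ)`. -/
instance (x₀ : M) : TopologicalSpace (FirstCohomology x₀) :=
  TopologicalSpace.induced (fun (μ : FirstCohomology x₀) (c : FirstHomology x₀) => μ c)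
    inferInstance

end Homology

/-! ### Flows, periodic orbits, orbit equivalences -/

section Flows

variable {M N : Type*} [TopologicalSpace M] [TopologicalSpace N]

/-- `T` is the (minimal positive) period of the point `x`; in particular `x` is a periodic point
and is not fixed by the flow. -/
def IsPeriodOf (X : Flow ℝ M) (x : M) (T : ℝ) : Prop :=
  IsLeast {t : ℝ | 0 < t ∧ X t x = x} T

/-- The loop `s ↦ X^{sT}(x)`, `s ∈ [0,1]`, for a point with `X^T(x) = x`. -/
def orbitLoop (X : Flow ℝ M) (x : M) (T : ℝ) (hT : X T x = x) : Path x x where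
  toFun s := X ((s : ℝ) * T) x
  continuous_toFun :=
    X.continuous (continuous_subtype_val.mul continuous_const) continuous_const
  source' := by simp
  target' := by simpa using hT

/-- `h` sends the orbits of `X` onto the orbits of `Y` and preserves the time direction:
along every orbit time is changed by an increasing bijection of `ℝ`. -/
def IsOrbitEquivalence (X : Flow ℝ M) (Y : Flow ℝ N) (h : M → N) : Prop :=
  ∀ x : M, ∃ τ : ℝ ≃o ℝ, τ 0 = 0 ∧ ∀ t : ℝ, h (X t x) = Y (τ t) (h x)

end Flows

/-! ### Smooth flows, Anosov flows and contact flows -/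

section SmoothFlows

variable {E : Type*} [NormedAddCommGroup E] [NormedSpace ℝ E]
  {M : Type*} [TopologicalSpace M] [ChartedSpace E M]

variable (E) in
/-- The flow is smooth, jointly in time and space. -/
def IsSmoothFlow (X : Flow ℝ M) : Prop :=
  ContMDiff (𝓘(ℝ, ℝ).prod 𝓘(ℝ, E)) 𝓘(ℝ, E) ∞ (fun q : ℝ × M => X q.1 q.2)

variable (E) in
/-- The vector field generating a flow: the velocity of `t ↦ X^t(x)` at `t = 0`. -/
def flowGenerator (X : Flow ℝ M) (x : M) : TangentSpace 𝓘(ℝ, E) x :=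
  (mfderiv 𝓘(ℝ, ℝ) 𝓘(ℝ, E) (fun t : ℝ => X t x) 0 : ℝ →L[ℝ] E) 1

variable (E) in
/-- The derivative `DX^t` at `x`. -/
def flowDeriv (X : Flow ℝ M) (t : ℝ) (x : M) :
    TangentSpace 𝓘(ℝ, E) x →L[ℝ] TangentSpace 𝓘(ℝ, E) (X t x) :=
  mfderiv 𝓘(ℝ, E) 𝓘(ℝ, E) (fun y : M => X t y) x

/-- The length of a tangent vector in a Riemannian metric. -/
def metricNorm [IsManifold 𝓘(ℝ, E) ∞ M]
    (g : Bundle.ContMDiffRiemannianMetric 𝓘(ℝ, E) ∞ E (fun x : M => TangentSpace 𝓘(ℝ, E) x))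
    {x : M} (v : TangentSpace 𝓘(ℝ, E) x) : ℝ :=
  Real.sqrt (g.inner x v v)

variable (E) in
/-- A flow on a compact manifold is Anosov if its generator has no zeros and the tangent bundle
has a `DX^t`-invariant splitting `E^s ⊕ ℝX ⊕ E^u` such that, for a Riemannian metric, `DX^t`
contracts `E^s` exponentially for `t ≥ 0` and `DX^{-t}` contracts `E^u` exponentially
for `t ≥ 0`. -/
def IsAnosovFlow [IsManifold 𝓘(ℝ, E) ∞ M] (X : Flow ℝ M) : Prop :=
  ∃ (g : Bundle.ContMDiffRiemannianMetric 𝓘(ℝ, E) ∞ E (fun x : M => TangentSpace 𝓘(ℝ, E) x))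
    (Es Eu : ∀ x : M, Submodule ℝ (TangentSpace 𝓘(ℝ, E) x)) (C lam : ℝ),
    0 < C ∧ 0 < lam ∧
    (∀ x, flowGenerator E X x ≠ 0) ∧
    (∀ x, DirectSum.IsInternal ![Es x, Submodule.span ℝ {flowGenerator E X x}, Eu x]) ∧
    (∀ t x, (Es x).map (flowDeriv E X t x : _ →ₗ[ℝ] TangentSpace 𝓘(ℝ, E) (X t x))
      = Es (X t x)) ∧
    (∀ t x, (Eu x).map (flowDeriv E X t x : _ →ₗ[ℝ] TangentSpace 𝓘(ℝ, E) (X t x))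
      = Eu (X t x)) ∧
    (∀ t, 0 ≤ t → ∀ x, ∀ v ∈ Es x,
      metricNorm g (flowDeriv E X t x v) ≤ C * Real.exp (-lam * t) * metricNorm g v) ∧
    (∀ t, 0 ≤ t → ∀ x, ∀ v ∈ Eu x,
      metricNorm g (flowDeriv E X (-t) x v) ≤ C * Real.exp (-lam * t) * metricNorm g v)

/-- A 1-form (not necessarily smooth) is a family of linear functionals on the tangent spaces;
this says that it is a smooth section of the cotangent bundle. -/
def IsSmoothOneForm [IsManifold 𝓘(ℝ, E) ∞ M]
    (β : ∀ x : M, TangentSpace 𝓘(ℝ, E) x →L[ℝ] ℝ) : Prop :=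
  ContMDiff 𝓘(ℝ, E) (𝓘(ℝ, E).prod 𝓘(ℝ, E →L[ℝ] ℝ)) ∞
    (fun x => Bundle.TotalSpace.mk' (E →L[ℝ] ℝ)
      (E := fun x : M => TangentSpace 𝓘(ℝ, E) x →L[ℝ] Bundle.Trivial M ℝ x) x (β x))

/-- The expression of a 1-form in the chart at `x₀`: its pull-back under the inverse chart. -/
def oneFormInChart (β : ∀ x : M, TangentSpace 𝓘(ℝ, E) x →L[ℝ] ℝ) (x₀ : M) (y : E) :
    E →L[ℝ] ℝ :=
  (β ((extChartAt 𝓘(ℝ, E) x₀).symm y)).comp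
    (mfderiv 𝓘(ℝ, E) 𝓘(ℝ, E) (extChartAt 𝓘(ℝ, E) x₀).symm y)

/-- The exterior derivative of a 1-form at `x`, computed in the chart at `x`:
`dβ(v, w) = ∂_v β(w) - ∂_w β(v)`. -/
def oneFormExtDeriv (β : ∀ x : M, TangentSpace 𝓘(ℝ, E) x →L[ℝ] ℝ) (x : M)
    (v w : TangentSpace 𝓘(ℝ, E) x) : ℝ :=
  let D : TangentSpace 𝓘(ℝ, E) x →L[ℝ] E :=
    mfderiv 𝓘(ℝ, E) 𝓘(ℝ, E) (extChartAt 𝓘(ℝ, E) x) x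
  let dB : E →L[ℝ] E →L[ℝ] ℝ :=
    fderiv ℝ (oneFormInChart β x) (extChartAt 𝓘(ℝ, E) x x)
  dB (D v) (D w) - dB (D w) (D v)

/-- The value of `β ∧ (dβ)^k` at `x` on `2k+1` tangent vectors, up to a positive constant that
depends only on `k` and on the normalization of the wedge product. -/
def contactVolume (β : ∀ x : M, TangentSpace 𝓘(ℝ, E) x →L[ℝ] ℝ) (k : ℕ) (x : M)
    (v : Fin (2 * k + 1) → TangentSpace 𝓘(ℝ, E) x) : ℝ :=
  ∑ σ : Equiv.Perm (Fin (2 * k + 1)), ((Equiv.Perm.sign σ : ℤ) : ℝ) *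
    (β x (v (σ 0)) * ∏ i : Fin k,
      oneFormExtDeriv β x (v (σ ⟨2 * (i : ℕ) + 1, by omega⟩))
        (v (σ ⟨2 * (i : ℕ) + 2, by omega⟩)))

/-- `β` is a contact form on a `(2k+1)`-dimensional manifold: `β` is smooth and `β ∧ (dβ)^k`
vanishes nowhere. -/
def IsContactForm [IsManifold 𝓘(ℝ, E) ∞ M]
    (β : ∀ x : M, TangentSpace 𝓘(ℝ, E) x →L[ℝ] ℝ) : Prop :=
  IsSmoothOneForm β ∧ ∃ k : ℕ, Module.finrank ℝ E = 2 * k + 1 ∧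
    ∀ x, ∃ v : Fin (2 * k + 1) → TangentSpace 𝓘(ℝ, E) x, contactVolume β k x v ≠ 0

variable (E) in
/-- A flow is contact if its generator is the Reeb vector field of a contact form. -/
def IsContactFlow [IsManifold 𝓘(ℝ, E) ∞ M] (X : Flow ℝ M) : Prop :=
  ∃ β : ∀ x : M, TangentSpace 𝓘(ℝ, E) x →L[ℝ] ℝ, IsContactForm β ∧
    (∀ x, β x (flowGenerator E X x) = 1) ∧
    ∀ x v, oneFormExtDeriv β x (flowGenerator E X x) v = 0

end SmoothFlows

/-! ### The universal abelian cover and the deformation -/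

section Cover

variable {M M' : Type*} [TopologicalSpace M] [TopologicalSpace M']

/-- `p : M' → M`, with `M'` connected, is the universal abelian cover of the manifold `M`: a smooth
covering for which the image of the fundamental group of `M'` is the commutator subgroup of the
fundamental group of `M`. -/
structure IsUniversalAbelianCover (E : Type*) [NormedAddCommGroup E] [NormedSpace ℝ E]
    [ChartedSpace E M] [ChartedSpace E M'] [PathConnectedSpace M'] (p : C(M', M)) : Prop where
  isCoveringMap : IsCoveringMap p
  isLocalDiffeomorph : IsLocalDiffeomorph 𝓘(ℝ, E) 𝓘(ℝ, E) ∞ p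
  range_map : ∀ y : M', (FundamentalGroup.map p y).range = commutator (FundamentalGroup M (p y))

/-- The group of deck transformations of `p`. -/
def deckGroup (p : C(M', M)) : Subgroup (M' ≃ₜ M') where
  carrier := {g | ∀ y, p (g y) = p y}
  one_mem' _ := rfl
  mul_mem' {a b} ha hb y := (ha (b y)).trans (hb y)
  inv_mem' {a} ha y := by
    have h := ha (a⁻¹ y)
    rw [← h]
    exact congrArg p (a.apply_symm_apply y)

/-- The homology class of a deck transformation `g`: the class of the projection to `M` of a path
from `y₀` to `g y₀`. For the universal abelian cover this is the isomorphism of the deck group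
with `H₁(M, ℤ)`. -/
def deckClass [PathConnectedSpace M'] (p : C(M', M)) (y₀ : M') (g : deckGroup p) :
    FirstHomology (p y₀) :=
  basedLoopClass (p y₀)
    (((PathConnectedSpace.somePath y₀ (g.1 y₀)).map p.continuous).cast rfl (g.2 y₀).symm)

/-- The transformation `I_μ(g) = g ∘ X̃^{μ(g)}` of the cover. The group `Γ_μ` consists of all
`I_μ(g)`, `g` a deck transformation. -/
def deformedDeck [PathConnectedSpace M'] (p : C(M', M)) (X' : Flow ℝ M') (y₀ : M')
    (μ : FirstCohomology (p y₀)) (g : deckGroup p) (y : M') : M' :=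
  g.1 (X' (μ (deckClass p y₀ g)) y)

/-- The orbit space `M_μ` of the action of `Γ_μ` on the cover, with the quotient topology.
(Deck transformations commute with the lifted flow and `deckClass` is a homomorphism, so `Γ_μ` is
a group and the relation below is its orbit relation.) -/
def DeformedSpace [PathConnectedSpace M'] (p : C(M', M)) (X' : Flow ℝ M') (y₀ : M')
    (μ : FirstCohomology (p y₀)) : Type _ :=
  Quot (fun y z : M' => ∃ g : deckGroup p, z = deformedDeck p X' y₀ μ g y)

instance [PathConnectedSpace M'] (p : C(M', M)) (X' : Flow ℝ M') (y₀ : M')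
    (μ : FirstCohomology (p y₀)) : TopologicalSpace (DeformedSpace p X' y₀ μ) :=
  inferInstanceAs (TopologicalSpace (Quot _))

/-- The projection of the cover onto the orbit space `M_μ`. -/
def deformedProj [PathConnectedSpace M'] (p : C(M', M)) (X' : Flow ℝ M') (y₀ : M')
    (μ : FirstCohomology (p y₀)) (y : M') : DeformedSpace p X' y₀ μ :=
  Quot.mk _ y

end Cover

end

/-! Choose on the cover a smooth function `f` with `f (g z) = f z + μ(g)` for every deck
transformation `g`; it is glued from locally constant homology classes by a partition of unity of
`M`, hence linear in `μ`. Its differential descends to a closed 1-form `α` on `M` in the class `μ`,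
and the integral of `α` along the orbit piece from `x` to `X^s(x)` is a cocycle `A s x`, equal to `f
(X'^s z) - f z` for any `z` over `x`.

The map `z ↦ X'^{f(z)}(z)` (`shear`) conjugates the deck group to `Γ_μ`, because deck
transformations commute with the lifted flow (`shear_deck`). When `|α(X)| < 1/2` on `M`, the
function `s ↦ s + A s x` is an increasing bijection of `ℝ`, so the shear is a diffeomorphism and
induces a bijection of `M` with `M_μ`. The bound defines the neighbourhood of `0`; it is an open
condition because `M` is compact. The manifold structure of `M_μ` is carried over from `M`
(`deformedHomeomorph`), and all properties of `X_μ` are proved on `M`.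

There the flow becomes the time change `Y` of `X` with `Y^{s + A s x}(x) = X^s(x)`
(`IsSmallCocycle.flow`). Orbits are kept, and a closed orbit of period `T` and class `γ` gets the
period `T + A T x = T + μ(γ)`. Differentiating the relation in `s` and in `x` shows that the bundle
map `v ↦ v + α(v) X` carries the generator of `Y` to that of `X` and intertwines the derivatives of
the two flows (`shear_flowVelocity`, `shear_flowJacobian`). Pulling back an Anosov splitting of `X`
by it gives one for `Y`. If `X` is the Reeb field of `β`, then `Y` is the Reeb field of `β + α`: `α`
is closed, and `β + α` is `β` composed with the bundle map. -/

open scoped Manifold ContDiff Topology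

noncomputable section

/-! ### Transport of flows, metrics and forms along a chart-preserving homeomorphism -/

section Transport

variable {E : Type*} [NormedAddCommGroup E] [NormedSpace ℝ E]
  {M : Type*} [TopologicalSpace M] [ChartedSpace E M]
  {N : Type*} [TopologicalSpace N]

variable (E) in
/-- The charted space structure on `N` pulled back by a homeomorphism `e : N ≃ₜ M`. -/
@[reducible]
def Homeomorph.pullbackChartedSpace (e : N ≃ₜ M) : ChartedSpace E N where
  atlas := {c | ∃ c' ∈ atlas E M, c = e.toOpenPartialHomeomorph.trans c'}
  chartAt n := e.toOpenPartialHomeomorph.trans (chartAt E (e n))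
  mem_chart_source n := by simp
  chart_mem_atlas n := ⟨_, chart_mem_atlas E (e n), rfl⟩

/-- In a change of charts `e` cancels against its inverse, so the transition maps are those of `M`.
-/
theorem Homeomorph.isManifold_pullback [IsManifold 𝓘(ℝ, E) ∞ M] (e : N ≃ₜ M) :
    @IsManifold ℝ _ E _ _ E _ 𝓘(ℝ, E) ∞ N _ (e.pullbackChartedSpace E) := by
  let _ := e.pullbackChartedSpace E
  refine isManifold_of_contDiffOn _ _ _ ?_
  rintro _ _ ⟨c, hc, rfl⟩ ⟨c', hc', rfl⟩
  have := (contDiffGroupoid ∞ 𝓘(ℝ, E)).compatible hc hc'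
  have h2 := (mem_groupoid_of_pregroupoid.1 this).1
  simpa [contDiffPregroupoid, Function.comp_def, Set.preimage_preimage] using h2

variable [ChartedSpace E N]

variable (E) in
/-- The preferred charts of `N` are the pull-backs by `e` of the preferred charts of `M`. -/
def Homeomorph.PreservesCharts (e : N ≃ₜ M) : Prop :=
  ∀ n, chartAt E n = e.toOpenPartialHomeomorph.trans (chartAt E (e n))

namespace Homeomorph.PreservesCharts

variable {e : N ≃ₜ M} (he : e.PreservesCharts E)
include he

omit [NormedSpace ℝ E] in
theorem chartAt_apply (n y : N) : chartAt E n y = chartAt E (e n) (e y) := by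
  rw [he]; rfl

omit [NormedSpace ℝ E] in
theorem chartAt_symm_apply (n : N) (v : E) :
    (chartAt E n).symm v = e.symm ((chartAt E (e n)).symm v) := by
  rw [he]; rfl

omit [NormedSpace ℝ E] in
theorem chartAt_source (n : N) : (chartAt E n).source = e ⁻¹' (chartAt E (e n)).source := by
  rw [he]; simp

theorem extChartAt_eq (n : N) :
    (extChartAt 𝓘(ℝ, E) n : N → E) = extChartAt 𝓘(ℝ, E) (e n) ∘ e := by
  ext v; simp [he.chartAt_apply]

theorem extChartAt_symm_eq (n : N) :
    ((extChartAt 𝓘(ℝ, E) n).symm : E → N) = e.symm ∘ (extChartAt 𝓘(ℝ, E) (e n)).symm := by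
  ext v; simp [he.chartAt_symm_apply]

theorem contMDiff [IsManifold 𝓘(ℝ, E) ∞ M] : ContMDiff 𝓘(ℝ, E) 𝓘(ℝ, E) ∞ e := by
  intro n
  have h := (contMDiff_id (I := 𝓘(ℝ, E)) (M := M) (n := ∞)) (e n)
  rw [contMDiffAt_iff] at h ⊢
  refine ⟨e.continuous.continuousAt, ?_⟩
  convert h.2 using 1
  · ext v
    simp [he.chartAt_symm_apply]
  · simp [he.chartAt_apply]

theorem contMDiff_symm [IsManifold 𝓘(ℝ, E) ∞ M] : ContMDiff 𝓘(ℝ, E) 𝓘(ℝ, E) ∞ e.symm := by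
  intro x
  have h := (contMDiff_id (I := 𝓘(ℝ, E)) (M := M) (n := ∞)) x
  rw [contMDiffAt_iff] at h ⊢
  refine ⟨e.symm.continuous.continuousAt, ?_⟩
  convert h.2 using 1
  · ext v
    simp [he.chartAt_apply]

/-- A homeomorphism that preserves charts is a diffeomorphism. -/
def diffeomorph [IsManifold 𝓘(ℝ, E) ∞ M] : N ≃ₘ^∞⟮𝓘(ℝ, E), 𝓘(ℝ, E)⟯ M :=
  { e.toEquiv with
    contMDiff_toFun := he.contMDiff
    contMDiff_invFun := he.contMDiff_symm }

/-- In the preferred charts at `n` and `e n` the map `e` reads as the identity, and both tangent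
spaces are `E` by definition. This is why tensors on `M` can be reused on `N` with the same values
in `E`. -/
theorem hasMFDerivAt (n : N) :
    HasMFDerivAt 𝓘(ℝ, E) 𝓘(ℝ, E) e n (ContinuousLinearMap.id ℝ E) := by
  refine ⟨e.continuous.continuousAt, ?_⟩
  have := (hasMFDerivAt_id (I := 𝓘(ℝ, E)) (e n)).2
  have h2 : writtenInExtChartAt 𝓘(ℝ, E) 𝓘(ℝ, E) n e
      = writtenInExtChartAt 𝓘(ℝ, E) 𝓘(ℝ, E) (e n) id := by
    ext v
    simp [writtenInExtChartAt, he.chartAt_symm_apply]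
  rw [h2, he.extChartAt_eq]
  exact this

theorem symm_hasMFDerivAt (x : M) :
    HasMFDerivAt 𝓘(ℝ, E) 𝓘(ℝ, E) e.symm x (ContinuousLinearMap.id ℝ E) := by
  refine ⟨e.symm.continuous.continuousAt, ?_⟩
  have := (hasMFDerivAt_id (I := 𝓘(ℝ, E)) x).2
  have h2 : writtenInExtChartAt 𝓘(ℝ, E) 𝓘(ℝ, E) x e.symm
      = writtenInExtChartAt 𝓘(ℝ, E) 𝓘(ℝ, E) x id := by
    ext v
    simp [writtenInExtChartAt, he.chartAt_apply]
  rw [h2]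
  exact this

theorem mfderiv_symm_comp {F P : Type*} [NormedAddCommGroup F] [NormedSpace ℝ F]
    [TopologicalSpace P] [ChartedSpace F P] {f : P → M} {x : P}
    (hf : MDifferentiableAt 𝓘(ℝ, F) 𝓘(ℝ, E) f x) :
    (mfderiv 𝓘(ℝ, F) 𝓘(ℝ, E) (fun y => e.symm (f y)) x : F →L[ℝ] E)
      = (mfderiv 𝓘(ℝ, F) 𝓘(ℝ, E) f x : F →L[ℝ] E) := by
  have := ((he.symm_hasMFDerivAt (f x)).comp x hf.hasMFDerivAt).mfderiv
  exact this.trans (ContinuousLinearMap.id_comp (mfderiv 𝓘(ℝ, F) 𝓘(ℝ, E) f x : F →L[ℝ] E))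

theorem mfderiv_comp {F P : Type*} [NormedAddCommGroup F] [NormedSpace ℝ F]
    [TopologicalSpace P] [ChartedSpace F P] {f : M → P} {n : N}
    (hf : MDifferentiableAt 𝓘(ℝ, E) 𝓘(ℝ, F) f (e n)) :
    (mfderiv 𝓘(ℝ, E) 𝓘(ℝ, F) (fun y => f (e y)) n : E →L[ℝ] F)
      = (mfderiv 𝓘(ℝ, E) 𝓘(ℝ, F) f (e n) : E →L[ℝ] F) := by
  have := (HasMFDerivAt.comp n hf.hasMFDerivAt (he.hasMFDerivAt n)).mfderiv
  exact this.trans (ContinuousLinearMap.comp_id (mfderiv 𝓘(ℝ, E) 𝓘(ℝ, F) f (e n) : E →L[ℝ] F))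

variable [IsManifold 𝓘(ℝ, E) ∞ M] [IsManifold 𝓘(ℝ, E) ∞ N] {X : Flow ℝ N} {Y : Flow ℝ M}
  (hXY : ∀ t n, e (X t n) = Y t (e n))
include hXY

omit [IsManifold 𝓘(ℝ, E) ∞ M] [IsManifold 𝓘(ℝ, E) ∞ N] he in
theorem flow_eq (t : ℝ) (n : N) : X t n = e.symm (Y t (e n)) := by rw [← hXY]; simp

omit [IsManifold 𝓘(ℝ, E) ∞ N] in
theorem isSmoothFlow (hY : IsSmoothFlow E Y) : IsSmoothFlow E X := by
  have h1 : ContMDiff (𝓘(ℝ, ℝ).prod 𝓘(ℝ, E)) (𝓘(ℝ, ℝ).prod 𝓘(ℝ, E)) ∞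
      (fun q : ℝ × N => (q.1, e q.2)) :=
    contMDiff_fst.prodMk (he.contMDiff.comp contMDiff_snd)
  have := he.contMDiff_symm.comp (ContMDiff.comp hY h1)
  refine this.congr fun q => ?_
  simp [← hXY]

end Homeomorph.PreservesCharts

theorem IsSmoothFlow.contMDiff {X : Flow ℝ M} (hX : IsSmoothFlow E X) :
    ContMDiff (𝓘(ℝ, ℝ).prod 𝓘(ℝ, E)) 𝓘(ℝ, E) ∞ (fun q : ℝ × M => X q.1 q.2) := hX

theorem IsSmoothFlow.contMDiff_time {X : Flow ℝ M} (hX : IsSmoothFlow E X) (x : M) :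
    ContMDiff 𝓘(ℝ, ℝ) 𝓘(ℝ, E) ∞ (fun t : ℝ => X t x) :=
  hX.contMDiff.comp (contMDiff_id.prodMk contMDiff_const)

theorem IsSmoothFlow.contMDiff_space {X : Flow ℝ M} (hX : IsSmoothFlow E X) (t : ℝ) :
    ContMDiff 𝓘(ℝ, E) 𝓘(ℝ, E) ∞ (fun x : M => X t x) :=
  hX.contMDiff.comp (contMDiff_const.prodMk contMDiff_id)

namespace Homeomorph.PreservesCharts

variable {e : N ≃ₜ M} (he : e.PreservesCharts E) {X : Flow ℝ N} {Y : Flow ℝ M}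
  (hXY : ∀ t n, e (X t n) = Y t (e n)) (hY : IsSmoothFlow E Y)
include he hXY hY

theorem flowGenerator_eq (n : N) :
    (flowGenerator E X n : E) = (flowGenerator E Y (e n) : E) := by
  unfold flowGenerator
  have h : (fun t : ℝ => X t n) = fun t => e.symm (Y t (e n)) := by
    ext t; exact flow_eq hXY t n
  rw [h]
  have := he.mfderiv_symm_comp (f := fun t : ℝ => Y t (e n)) (x := 0)
    ((hY.contMDiff_time (e n)).mdifferentiable (by simp) 0)
  exact congrArg (fun L : ℝ →L[ℝ] E => L 1) this

theorem flowDeriv_eq [IsManifold 𝓘(ℝ, E) ∞ M] (t : ℝ) (n : N) :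
    (flowDeriv E X t n : E →L[ℝ] E) = (flowDeriv E Y t (e n) : E →L[ℝ] E) := by
  unfold flowDeriv
  have h : (fun y : N => X t y) = fun y => e.symm (Y t (e y)) := by
    ext y; exact flow_eq hXY t y
  rw [h]
  have hd := (hY.contMDiff_space t).mdifferentiable (by simp) (e n)
  have h1 := he.mfderiv_symm_comp (f := fun y : N => Y t (e y)) (x := n)
    (hd.comp n (he.contMDiff.mdifferentiable (by simp) n))
  exact h1.trans (he.mfderiv_comp hd)

end Homeomorph.PreservesCharts

end Transport

section Transport2

variable {E : Type*} [NormedAddCommGroup E] [NormedSpace ℝ E]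
  {M : Type*} [TopologicalSpace M] [ChartedSpace E M]
  {N : Type*} [TopologicalSpace N] [ChartedSpace E N]

theorem TangentBundle.inCoordinates_bilin_apply [IsManifold 𝓘(ℝ, E) ∞ N] {n₀ n : N}
    (φ : TangentSpace 𝓘(ℝ, E) n →L[ℝ] TangentSpace 𝓘(ℝ, E) n →L[ℝ] ℝ)
    (hn : n ∈ (chartAt E n₀).source) (v w : E) :
    ContinuousLinearMap.inCoordinates E (TangentSpace 𝓘(ℝ, E)) (E →L[ℝ] ℝ)
      (fun x : N => TangentSpace 𝓘(ℝ, E) x →L[ℝ] ℝ) n₀ n n₀ n φ v w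
    = φ ((trivializationAt E (TangentSpace 𝓘(ℝ, E)) n₀).symmL ℝ n v)
      ((trivializationAt E (TangentSpace 𝓘(ℝ, E)) n₀).symmL ℝ n w) := by
  have := inCoordinates_apply_eq₂ (𝕜 := ℝ) (F₁ := E) (E₁ := TangentSpace 𝓘(ℝ, E) (M := N)) (F₂ := E) (E₂ := TangentSpace 𝓘(ℝ, E) (M := N)) (F₃ := ℝ) (E₃ := Bundle.Trivial N ℝ) (x₀ := n₀) (x := n) (ϕ := φ) (v := v) (w := w) (by simpa using hn) (by simpa using hn) (by simp)
  refine this.trans ?_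
  simp only [Bundle.Trivial.linearMapAt_trivialization, Bundle.Trivial.fiberBundle_trivializationAt',
    LinearMap.id_apply]
  rw [Bundle.Trivialization.symmL_apply _ (by simpa using hn), Bundle.Trivialization.symmL_apply _ (by simpa using hn)]

theorem TangentBundle.inCoordinates_form_apply [IsManifold 𝓘(ℝ, E) ∞ N] {n₀ n : N}
    (φ : TangentSpace 𝓘(ℝ, E) n →L[ℝ] ℝ) (v : E) :
    ContinuousLinearMap.inCoordinates E (TangentSpace 𝓘(ℝ, E)) ℝ
      (Bundle.Trivial N ℝ) n₀ n n₀ n φ v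
    = φ ((trivializationAt E (TangentSpace 𝓘(ℝ, E)) n₀).symmL ℝ n v) := by
  unfold ContinuousLinearMap.inCoordinates
  simp only [Bundle.Trivial.fiberBundle_trivializationAt', Bundle.Trivial.continuousLinearMapAt_trivialization]
  rfl

namespace Homeomorph.PreservesCharts

variable {e : N ≃ₜ M} (he : e.PreservesCharts E)
variable [IsManifold 𝓘(ℝ, E) ∞ M] [IsManifold 𝓘(ℝ, E) ∞ N] 
include he

/-- Tensor fields on `M` and their transports to `N` have the same coordinate expressions, up to
`e`; smoothness of pulled-back metrics and forms rests on this. -/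
theorem symmL_trivializationAt_eq {n₀ n : N} (hn : n ∈ (chartAt E n₀).source) :
    ((trivializationAt E (TangentSpace 𝓘(ℝ, E)) n₀).symmL ℝ n : E →L[ℝ] E) =
    ((trivializationAt E (TangentSpace 𝓘(ℝ, E)) (e n₀)).symmL ℝ (e n) : E →L[ℝ] E) := by
  have hn' : e n ∈ (chartAt E (e n₀)).source := by rwa [he.chartAt_source] at hn
  have h1 := TangentBundle.symmL_trivializationAt (I := 𝓘(ℝ, E)) hn
  have h2 := TangentBundle.symmL_trivializationAt (I := 𝓘(ℝ, E)) hn'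
  refine h1.trans (Eq.trans ?_ h2.symm)
  simp only [modelWithCornersSelf_coe, Set.range_id, mfderivWithin_univ]
  rw [he.extChartAt_symm_eq, he.extChartAt_eq]
  refine he.mfderiv_symm_comp ?_
  have := mdifferentiableWithinAt_extChartAt_symm (I := 𝓘(ℝ, E)) (x := e n₀) (z := extChartAt 𝓘(ℝ, E) (e n₀) (e n)) (by simp [hn'])
  simpa [mdifferentiableWithinAt_univ] using this

theorem contMDiff_bilin_pullback
    {g : ∀ x : M, TangentSpace 𝓘(ℝ, E) x →L[ℝ] TangentSpace 𝓘(ℝ, E) x →L[ℝ] ℝ}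
    (hg : ContMDiff 𝓘(ℝ, E) (𝓘(ℝ, E).prod 𝓘(ℝ, E →L[ℝ] E →L[ℝ] ℝ)) ∞
    (fun b ↦ Bundle.TotalSpace.mk' (E →L[ℝ] E →L[ℝ] ℝ) (E := fun x : M => TangentSpace 𝓘(ℝ, E) x →L[ℝ] TangentSpace 𝓘(ℝ, E) x →L[ℝ] ℝ) b (g b))) :
    ContMDiff 𝓘(ℝ, E) (𝓘(ℝ, E).prod 𝓘(ℝ, E →L[ℝ] E →L[ℝ] ℝ)) ∞
    (fun b : N ↦ Bundle.TotalSpace.mk' (E →L[ℝ] E →L[ℝ] ℝ) (E := fun x : N => TangentSpace 𝓘(ℝ, E) x →L[ℝ] TangentSpace 𝓘(ℝ, E) x →L[ℝ] ℝ) b (g (e b) : E →L[ℝ] E →L[ℝ] ℝ)) := by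
  intro n₀
  have h := hg (e n₀)
  rw [contMDiffAt_hom_bundle] at h ⊢
  refine ⟨contMDiffAt_id, ?_⟩
  have h2 := h.2.comp n₀ (he.contMDiff n₀)
  refine h2.congr_of_eventuallyEq ?_
  filter_upwards [(chartAt E n₀).open_source.mem_nhds (mem_chart_source E n₀)] with n hn
  have hn' : e n ∈ (chartAt E (e n₀)).source := by rwa [he.chartAt_source] at hn
  ext v w
  have key := fun u : E => congrArg (fun L : E →L[ℝ] E => L u) (he.symmL_trivializationAt_eq hn)
  have a1 := TangentBundle.inCoordinates_bilin_apply (n₀ := n₀) (n := n) (g (e n)) hn v w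
  have a2 := TangentBundle.inCoordinates_bilin_apply (n₀ := e n₀) (n := e n) (g (e n)) hn' v w
  have mid := congrArg₂ (fun a b : E => (g (e n) : E →L[ℝ] E →L[ℝ] ℝ) a b) (key v) (key w)
  exact a1.trans (mid.trans a2.symm)

theorem isSmoothOneForm_pullback {β : ∀ x : M, TangentSpace 𝓘(ℝ, E) x →L[ℝ] ℝ}
    (hβ : IsSmoothOneForm β) :
    IsSmoothOneForm (fun n : N => ((β (e n) : E →L[ℝ] ℝ) : TangentSpace 𝓘(ℝ, E) n →L[ℝ] ℝ)) := by
  intro n₀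
  have h := hβ (e n₀)
  rw [contMDiffAt_hom_bundle] at h ⊢
  refine ⟨contMDiffAt_id, ?_⟩
  have h2 := h.2.comp n₀ (he.contMDiff n₀)
  refine h2.congr_of_eventuallyEq ?_
  filter_upwards [(chartAt E n₀).open_source.mem_nhds (mem_chart_source E n₀)] with n hn
  have hn' : e n ∈ (chartAt E (e n₀)).source := by rwa [he.chartAt_source] at hn
  ext v
  have key := fun u : E => congrArg (fun L : E →L[ℝ] E => L u) (he.symmL_trivializationAt_eq hn)
  have a1 := TangentBundle.inCoordinates_form_apply (n₀ := n₀) (n := n) (β (e n)) v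
  have a2 := TangentBundle.inCoordinates_form_apply (n₀ := e n₀) (n := e n) (β (e n)) v
  have mid := congrArg (fun a : E => (β (e n) : E →L[ℝ] ℝ) a) (key v)
  exact a1.trans (mid.trans a2.symm)

/-- The pull-back of a Riemannian metric. -/
def pullbackMetric
    (g : Bundle.ContMDiffRiemannianMetric 𝓘(ℝ, E) ∞ E (fun x : M => TangentSpace 𝓘(ℝ, E) x)) :
    Bundle.ContMDiffRiemannianMetric 𝓘(ℝ, E) ∞ E (fun x : N => TangentSpace 𝓘(ℝ, E) x) where
  inner n := (g.inner (e n) : E →L[ℝ] E →L[ℝ] ℝ)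
  symm n v w := g.symm (e n) v w
  pos n v hv := g.pos (e n) v hv
  isVonNBounded n := g.isVonNBounded (e n)
  contMDiff := he.contMDiff_bilin_pullback g.contMDiff

variable {X : Flow ℝ N} {Y : Flow ℝ M} (hXY : ∀ t n, e (X t n) = Y t (e n))
include hXY

theorem isAnosovFlow (hY : IsSmoothFlow E Y) (h : IsAnosovFlow E Y) : IsAnosovFlow E X := by
  obtain ⟨g, Es, Eu, C, lam, hC, hlam, h0, hsplit, hs, hu, hsc, huc⟩ := h
  have hgen := he.flowGenerator_eq hXY hY
  have hder := he.flowDeriv_eq hXY hY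
  refine ⟨he.pullbackMetric g, fun n => (Es (e n) : Submodule ℝ E),
    fun n => (Eu (e n) : Submodule ℝ E), C, lam, hC, hlam, fun n => ?_, fun n => ?_,
    fun t n => ?_, fun t n => ?_, fun t ht n v hv => ?_, fun t ht n v hv => ?_⟩
  · intro h
    exact h0 (e n) ((hgen n).symm.trans h)
  · have := hsplit (e n)
    have h2 : DirectSum.IsInternal ![(Es (e n) : Submodule ℝ E),
      Submodule.span ℝ {(flowGenerator E X n : E)}, (Eu (e n) : Submodule ℝ E)] := by
      rw [hgen n]; exact this
    exact h2
  · have h1 := hs t (e n)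
    have h2 : (Es (e n) : Submodule ℝ E).map
        (ContinuousLinearMap.toLinearMap (flowDeriv E X t n : E →L[ℝ] E))
        = (Es (Y t (e n)) : Submodule ℝ E) := by
      rw [hder]; exact h1
    -- The fibres over `e (X t n)` and `Y t (e n)` are both `E`, so the change of base point is an
    -- equation between subspaces of `E` and no dependent rewriting is needed.
    have h3 := congrArg (fun x : M => (show Submodule ℝ E from Es x)) (hXY t n).symm
    exact h2.trans h3
  · have h1 := hu t (e n)
    have h2 : (Eu (e n) : Submodule ℝ E).map
        (ContinuousLinearMap.toLinearMap (flowDeriv E X t n : E →L[ℝ] E))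
        = (Eu (Y t (e n)) : Submodule ℝ E) := by
      rw [hder]; exact h1
    have h3 := congrArg (fun x : M => (show Submodule ℝ E from Eu x)) (hXY t n).symm
    exact h2.trans h3
  · refine le_trans (le_of_eq ?_) (hsc t ht (e n) v hv)
    have h1 : (flowDeriv E X t n v : E) = flowDeriv E Y t (e n) v :=
      congrArg (fun L : E →L[ℝ] E => L v) (hder t n)
    have h2 := congrArg₂ (fun (x : M) (u : E) => metricNorm g (x := x) u) (hXY t n) h1
    exact h2
  · refine le_trans (le_of_eq ?_) (huc t ht (e n) v hv)
    have h1 : (flowDeriv E X (-t) n v : E) = flowDeriv E Y (-t) (e n) v :=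
      congrArg (fun L : E →L[ℝ] E => L v) (hder (-t) n)
    have h2 := congrArg₂ (fun (x : M) (u : E) => metricNorm g (x := x) u) (hXY (-t) n) h1
    exact h2

omit [IsManifold 𝓘(ℝ, E) ∞ N] hXY in
theorem oneFormInChart_eventuallyEq (β : ∀ x : M, TangentSpace 𝓘(ℝ, E) x →L[ℝ] ℝ) (n : N) :
    oneFormInChart (fun n : N => ((β (e n) : E →L[ℝ] ℝ) : TangentSpace 𝓘(ℝ, E) n →L[ℝ] ℝ)) n
      =ᶠ[𝓝 (extChartAt 𝓘(ℝ, E) n n)] oneFormInChart β (e n) := by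
  have h : (extChartAt 𝓘(ℝ, E) (e n)).target ∈ 𝓝 (extChartAt 𝓘(ℝ, E) n n) := by
    rw [he.extChartAt_eq]
    exact extChartAt_target_mem_nhds (e n)
  filter_upwards [h] with y hy
  have hd : MDifferentiableAt 𝓘(ℝ, E) 𝓘(ℝ, E) (extChartAt 𝓘(ℝ, E) (e n)).symm y := by
    have := mdifferentiableWithinAt_extChartAt_symm (I := 𝓘(ℝ, E)) hy
    simpa [mdifferentiableWithinAt_univ] using this
  have h1 := he.mfderiv_symm_comp hd
  unfold oneFormInChart
  rw [he.extChartAt_symm_eq]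
  have h2 : e ((e.symm ∘ (extChartAt 𝓘(ℝ, E) (e n)).symm) y)
      = (extChartAt 𝓘(ℝ, E) (e n)).symm y := by simp
  have h3 := congrArg (fun x : M => (show E →L[ℝ] ℝ from β x)) h2
  exact congrArg₂ (fun (L : E →L[ℝ] ℝ) (D : E →L[ℝ] E) => L.comp D) h3 h1

omit [IsManifold 𝓘(ℝ, E) ∞ N] hXY in
theorem oneFormExtDeriv_eq (β : ∀ x : M, TangentSpace 𝓘(ℝ, E) x →L[ℝ] ℝ) (n : N) (v w : E) :
    oneFormExtDeriv (fun n : N => ((β (e n) : E →L[ℝ] ℝ) : TangentSpace 𝓘(ℝ, E) n →L[ℝ] ℝ)) n v w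
      = oneFormExtDeriv β (e n) v w := by
  have h1 := (he.oneFormInChart_eventuallyEq β n).fderiv_eq (𝕜 := ℝ)
  have h2 : (mfderiv 𝓘(ℝ, E) 𝓘(ℝ, E) (extChartAt 𝓘(ℝ, E) n) n : E →L[ℝ] E)
      = mfderiv 𝓘(ℝ, E) 𝓘(ℝ, E) (extChartAt 𝓘(ℝ, E) (e n)) (e n) := by
    rw [he.extChartAt_eq]
    exact he.mfderiv_comp (mdifferentiableAt_extChartAt (mem_chart_source E (e n)))
  have h3 : extChartAt 𝓘(ℝ, E) n n = extChartAt 𝓘(ℝ, E) (e n) (e n) := by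
    rw [he.extChartAt_eq]; rfl
  rw [h3] at h1
  unfold oneFormExtDeriv
  rw [h3]
  exact congrArg₂ (fun (dB : E →L[ℝ] E →L[ℝ] ℝ) (D : E →L[ℝ] E) =>
    dB (D v) (D w) - dB (D w) (D v)) h1 h2

theorem isContactFlow (hY : IsSmoothFlow E Y) (h : IsContactFlow E Y) : IsContactFlow E X := by
  obtain ⟨β, ⟨hβ, k, hk, hvol⟩, h1, h0⟩ := h
  have hgen := he.flowGenerator_eq hXY hY
  refine ⟨fun n => (β (e n) : E →L[ℝ] ℝ), ⟨he.isSmoothOneForm_pullback hβ, k, hk, fun n => ?_⟩,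
    fun n => ?_, fun n v => ?_⟩
  · obtain ⟨v, hv⟩ := hvol (e n)
    refine ⟨v, ?_⟩
    refine fun h => hv (Eq.trans (Finset.sum_congr rfl fun σ _ => ?_) h)
    exact congrArg₂ (· * ·) rfl (congrArg₂ (· * ·) rfl
      (Finset.prod_congr rfl fun i _ => (he.oneFormExtDeriv_eq β n _ _).symm))
  · exact (congrArg (β (e n) : E →L[ℝ] ℝ) (hgen n)).trans (h1 (e n))
  · refine (he.oneFormExtDeriv_eq β n _ _).trans ?_
    have := congrArg (fun u : E => oneFormExtDeriv β (e n) u v) (hgen n)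
    exact this.trans (h0 (e n) v)

end Homeomorph.PreservesCharts

end Transport2

/-! ### Smooth 1-forms, the generator of a flow, and closedness -/

section SmoothForms

variable {E : Type*} [NormedAddCommGroup E] [NormedSpace ℝ E]
  {M : Type*} [TopologicalSpace M] [ChartedSpace E M] [IsManifold 𝓘(ℝ, E) ∞ M]

/-- The differential of a function, as a 1-form. -/
def differential (f : M → ℝ) (x : M) : TangentSpace 𝓘(ℝ, E) x →L[ℝ] ℝ :=
  mfderiv 𝓘(ℝ, E) 𝓘(ℝ, ℝ) f x

theorem isSmoothOneForm_differential {f : M → ℝ} (hf : ContMDiff 𝓘(ℝ, E) 𝓘(ℝ, ℝ) ∞ f) :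
    IsSmoothOneForm (E := E) (differential f) := by
  intro x₀
  rw [contMDiffAt_hom_bundle]
  refine ⟨contMDiffAt_id, ?_⟩
  have h := (hf x₀).mfderiv_const (m := ∞) (by simp)
  refine h.congr_of_eventuallyEq (Filter.Eventually.of_forall fun x => ?_)
  unfold inTangentCoordinates ContinuousLinearMap.inCoordinates differential
  ext v
  simp
  rfl

theorem IsSmoothOneForm.congr_of_eventuallyEq
    {α : ∀ x : M, TangentSpace 𝓘(ℝ, E) x →L[ℝ] ℝ}
    (h : ∀ x, ∃ β : ∀ x : M, TangentSpace 𝓘(ℝ, E) x →L[ℝ] ℝ, IsSmoothOneForm β ∧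
      ∀ᶠ z in 𝓝 x, α z = β z) : IsSmoothOneForm α := by
  intro x
  obtain ⟨β, hβ, hαβ⟩ := h x
  refine (hβ x).congr_of_eventuallyEq ?_
  filter_upwards [hαβ] with z hz
  rw [hz]

theorem IsSmoothFlow.contMDiff_flowGenerator {X : Flow ℝ M} (hX : IsSmoothFlow E X) :
    ContMDiff 𝓘(ℝ, E) (𝓘(ℝ, E).prod 𝓘(ℝ, E)) ∞
      (fun x => Bundle.TotalSpace.mk' E (E := fun x : M => TangentSpace 𝓘(ℝ, E) x) x
        (flowGenerator E X x)) := by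
  intro x₀
  rw [Bundle.contMDiffAt_section]
  have hsm : ContMDiffAt (𝓘(ℝ, E).prod 𝓘(ℝ, ℝ)) 𝓘(ℝ, E) ∞ (Function.uncurry fun (x : M) (t : ℝ) => X t x) (x₀, (0 : ℝ)) :=
    (hX.contMDiff.comp (contMDiff_snd.prodMk contMDiff_fst)) (x₀, (0 : ℝ))
  have h := ContMDiffAt.mfderiv_apply (m := ∞) (fun (x : M) (t : ℝ) => X t x) (fun _ => (0 : ℝ)) id
    (fun _ => (1 : ℝ)) (x₀ := x₀) hsm contMDiffAt_const contMDiffAt_id contMDiffAt_const (by simp)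
  refine h.congr_of_eventuallyEq ?_
  filter_upwards [(chartAt E x₀).open_source.mem_nhds (mem_chart_source E x₀)] with x hx
  -- The derivative at time `0` formally lives over `X 0 x`, which equals `x` only propositionally;
  -- `key` allows the base point to be changed inside the trivialization.
  have key : ∀ z : M, z ∈ (chartAt E x₀).source → ∀ w : E,
      (trivializationAt E (TangentSpace 𝓘(ℝ, E)) x₀).linearMapAt ℝ z w
      = (trivializationAt E (TangentSpace 𝓘(ℝ, E)) x₀
        (Bundle.TotalSpace.mk' E (E := fun x : M => TangentSpace 𝓘(ℝ, E) x) z w)).2 := by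
    intro z hz w
    rw [Bundle.Trivialization.coe_linearMapAt_of_mem _ (by simpa using hz)]
  have h0 := X.map_zero_apply x
  have h1 := key (X 0 x) (by rwa [h0]) (flowGenerator E X x)
  have h2 := congrArg (fun z : M => (trivializationAt E (TangentSpace 𝓘(ℝ, E)) x₀
        (Bundle.TotalSpace.mk' E (E := fun x : M => TangentSpace 𝓘(ℝ, E) x) z
          (flowGenerator E X x : E))).2) h0
  refine (h1.trans h2).symm.trans ?_
  simp [inTangentCoordinates, ContinuousLinearMap.inCoordinates]
  rfl

theorem IsSmoothOneForm.contMDiff_apply {β : ∀ x : M, TangentSpace 𝓘(ℝ, E) x →L[ℝ] ℝ}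
    (hβ : IsSmoothOneForm β) {v : ∀ x : M, TangentSpace 𝓘(ℝ, E) x}
    (hv : ContMDiff 𝓘(ℝ, E) (𝓘(ℝ, E).prod 𝓘(ℝ, E)) ∞
      (fun x => Bundle.TotalSpace.mk' E (E := fun x : M => TangentSpace 𝓘(ℝ, E) x) x (v x))) :
    ContMDiff 𝓘(ℝ, E) 𝓘(ℝ, ℝ) ∞ (fun x => β x (v x)) := by
  intro x₀
  have := ContMDiff.clm_bundle_apply (b := id) (F₂ := ℝ) (E₂ := Bundle.Trivial M ℝ) (ϕ := β) hβ hv x₀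
  have h2 := (Bundle.contMDiffAt_section _).1 this
  simpa using h2

theorem IsSmoothOneForm.add {β γ : ∀ x : M, TangentSpace 𝓘(ℝ, E) x →L[ℝ] ℝ}
    (hβ : IsSmoothOneForm β) (hγ : IsSmoothOneForm γ) :
    IsSmoothOneForm (fun x => β x + γ x) := by
  exact ContMDiff.add_section hβ hγ

/-- Near the base point the pull-back under the inverse chart is the expression of the form in the
bundle trivialization, which is smooth by hypothesis. -/
theorem IsSmoothOneForm.differentiableAt_oneFormInChart {β : ∀ x : M, TangentSpace 𝓘(ℝ, E) x →L[ℝ] ℝ}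
    (hβ : IsSmoothOneForm β) (x₀ : M) :
    DifferentiableAt ℝ (oneFormInChart β x₀) (extChartAt 𝓘(ℝ, E) x₀ x₀) := by
  have h := ((contMDiffAt_hom_bundle _).1 (hβ x₀)).2
  have h1 : ContMDiffAt 𝓘(ℝ, E) 𝓘(ℝ, E) ∞ (extChartAt 𝓘(ℝ, E) x₀).symm (extChartAt 𝓘(ℝ, E) x₀ x₀) := by
    have := contMDiffOn_extChartAt_symm (I := 𝓘(ℝ, E)) (n := ∞) x₀
    exact this.contMDiffAt (extChartAt_target_mem_nhds x₀)
  have h2 := (ContMDiffAt.comp_of_eq h h1 (by simp)).contDiffAt.differentiableAt (by simp)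
  refine h2.congr_of_eventuallyEq ?_
  filter_upwards [extChartAt_target_mem_nhds (I := 𝓘(ℝ, E)) x₀] with y hy
  ext v
  refine Eq.trans ?_ (TangentBundle.inCoordinates_form_apply (n₀ := x₀) (n := (extChartAt 𝓘(ℝ, E) x₀).symm y) (β _) v).symm
  have h3 := TangentBundle.symmL_trivializationAt (I := 𝓘(ℝ, E)) (x₀ := x₀) (x := (extChartAt 𝓘(ℝ, E) x₀).symm y) (by simpa using (extChartAt 𝓘(ℝ, E) x₀).map_target hy)
  rw [h3]
  rw [(extChartAt 𝓘(ℝ, E) x₀).right_inv hy]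
  simp [oneFormInChart]
  rfl

/-- This is `d(df) = 0`: in the chart the added term is the derivative of `f ∘ φ.symm`, whose second
derivative is symmetric. -/
theorem oneFormExtDeriv_add_closed {β α : ∀ x : M, TangentSpace 𝓘(ℝ, E) x →L[ℝ] ℝ}
    (hβ : IsSmoothOneForm β) {f : M → ℝ} (hf : ContMDiff 𝓘(ℝ, E) 𝓘(ℝ, ℝ) ∞ f) {x : M}
    (hα : ∀ᶠ z in 𝓝 x, α z = differential f z) (v w : TangentSpace 𝓘(ℝ, E) x) :
    oneFormExtDeriv (fun x => β x + α x) x v w = oneFormExtDeriv β x v w := by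
  set φ := extChartAt 𝓘(ℝ, E) x with hφ
  have h1 : ContMDiffAt 𝓘(ℝ, E) 𝓘(ℝ, E) ∞ φ.symm (φ x) := by
    have := contMDiffOn_extChartAt_symm (I := 𝓘(ℝ, E)) (n := ∞) x
    exact this.contMDiffAt (extChartAt_target_mem_nhds x)
  have hF : ContDiffAt ℝ ∞ (f ∘ φ.symm) (φ x) := ((hf _).comp _ h1).contDiffAt
  have hsymm : IsSymmSndFDerivAt ℝ (f ∘ φ.symm) (φ x) :=
    hF.isSymmSndFDerivAt (by simpa using ENat.LEInfty.out)
  have hc : Filter.Tendsto φ.symm (𝓝 (φ x)) (𝓝 x) := by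
    have := h1.continuousAt.tendsto
    rwa [extChartAt_to_inv] at this
  have heq : oneFormInChart (fun x => β x + α x) x =ᶠ[𝓝 (φ x)]
      oneFormInChart β x + fderiv ℝ (f ∘ φ.symm) := by
    filter_upwards [hc.eventually hα, extChartAt_target_mem_nhds (I := 𝓘(ℝ, E)) x] with y hy hyt
    have hd : MDifferentiableAt 𝓘(ℝ, E) 𝓘(ℝ, E) φ.symm y := by
      have := mdifferentiableWithinAt_extChartAt_symm (I := 𝓘(ℝ, E)) hyt
      simpa only [modelWithCornersSelf_coe, Set.range_id, mdifferentiableWithinAt_univ] using this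
    have h3 := mfderiv_comp y ((hf (φ.symm y)).mdifferentiableAt (by simp)) hd
    rw [mfderiv_eq_fderiv] at h3
    simp only [oneFormInChart, Pi.add_apply]
    rw [hy, h3]
    rfl
  have hd2 := (hF.fderiv_right (m := 1) (by norm_num; exact ENat.LEInfty.out)).differentiableAt (by simp)
  have h4 := heq.fderiv_eq.trans (fderiv_add (hβ.differentiableAt_oneFormInChart x) hd2)
  unfold oneFormExtDeriv
  rw [h4]
  simp only [add_apply]
  have h5 := hsymm ((mfderiv 𝓘(ℝ, E) 𝓘(ℝ, E) φ x : E →L[ℝ] E) v) ((mfderiv 𝓘(ℝ, E) 𝓘(ℝ, E) φ x : E →L[ℝ] E) w)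
  simp only [← hφ]
  linear_combination h5

end SmoothForms

/-! ### Bounds for forms and vector fields in a Riemannian metric -/

section MetricBounds

variable {E : Type*} [NormedAddCommGroup E] [NormedSpace ℝ E]
  {M : Type*} [TopologicalSpace M] [ChartedSpace E M] [IsManifold 𝓘(ℝ, E) ∞ M]

open scoped Bundle in
-- A trivialization compares the metric with the norm of `E`, and by continuity the coordinates of
-- `α` stay bounded near `x₀`.
theorem exists_eventually_sq_form_le_metric
    (g : Bundle.ContMDiffRiemannianMetric 𝓘(ℝ, E) ∞ E (fun x : M => TangentSpace 𝓘(ℝ, E) x))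
    {α : ∀ x : M, TangentSpace 𝓘(ℝ, E) x →L[ℝ] ℝ} (hα : IsSmoothOneForm α) (x₀ : M) :
    ∃ K : ℝ, ∀ᶠ x in 𝓝 x₀, ∀ v, (α x v) ^ 2 ≤ K * g.inner x v v := by
  have h := ((contMDiffAt_hom_bundle _).1 (hα x₀)).2.continuousAt
  have h' := h.norm.eventually_lt_const (lt_add_one _)
  set K₁ := ‖ContinuousLinearMap.inCoordinates E (TangentSpace 𝓘(ℝ, E)) ℝ
      (Bundle.Trivial M ℝ) x₀ x₀ x₀ x₀ (α x₀)‖ + 1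
  have hC : ∃ C > 0, ∀ᶠ y in 𝓝 x₀, ∀ v : TangentSpace 𝓘(ℝ, E) y,
      ‖((trivializationAt E (TangentSpace 𝓘(ℝ, E)) x₀).continuousLinearMapAt ℝ y v : E)‖ ^ 2 ≤
        C * g.inner y v v := by
    let _ : Bundle.RiemannianBundle (fun x : M => TangentSpace 𝓘(ℝ, E) x) :=
      ⟨g.toContinuousRiemannianMetric.toRiemannianMetric⟩
    obtain ⟨C, hC, hy⟩ := eventually_norm_trivializationAt_lt E (fun x : M => TangentSpace 𝓘(ℝ, E) x) x₀
    refine ⟨C ^ 2, by positivity, ?_⟩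
    filter_upwards [hy] with y hy v
    have h1 := ((trivializationAt E (TangentSpace 𝓘(ℝ, E)) x₀).continuousLinearMapAt ℝ y).le_of_opNorm_le hy.le v
    have h2 : g.inner y v v = ‖v‖ ^ 2 := by
      rw [← real_inner_self_eq_norm_sq]; rfl
    rw [h2, ← mul_pow]
    gcongr
  obtain ⟨C, hC, hev⟩ := hC
  refine ⟨K₁ ^ 2 * C, ?_⟩
  filter_upwards [hev, h', (chartAt E x₀).open_source.mem_nhds (mem_chart_source E x₀)] with y hy hK hs v
  have h1 := TangentBundle.inCoordinates_form_apply (n₀ := x₀) (n := y) (α y) ((trivializationAt E (TangentSpace 𝓘(ℝ, E)) x₀).continuousLinearMapAt ℝ y v)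
  rw [Bundle.Trivialization.symmL_continuousLinearMapAt _ (by simpa using hs)] at h1
  rw [← h1]
  set u := ((trivializationAt E (TangentSpace 𝓘(ℝ, E)) x₀).continuousLinearMapAt ℝ y v : E)
  set L := ContinuousLinearMap.inCoordinates E (TangentSpace 𝓘(ℝ, E)) ℝ
      (Bundle.Trivial M ℝ) x₀ y x₀ y (α y)
  have h2 : ‖L u‖ ≤ K₁ * ‖u‖ := L.le_of_opNorm_le hK.le u
  calc (L u) ^ 2 = ‖L u‖ ^ 2 := by rw [Real.norm_eq_abs, sq_abs]
    _ ≤ (K₁ * ‖u‖) ^ 2 := by gcongr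
    _ = K₁ ^ 2 * ‖u‖ ^ 2 := by ring
    _ ≤ K₁ ^ 2 * (C * g.inner y v v) := by gcongr; exact hy v
    _ = _ := by ring

theorem metric_self_nonneg
    (g : Bundle.ContMDiffRiemannianMetric 𝓘(ℝ, E) ∞ E (fun x : M => TangentSpace 𝓘(ℝ, E) x))
    (x : M) (v : TangentSpace 𝓘(ℝ, E) x) : 0 ≤ g.inner x v v := by
  by_cases h : v = 0
  · simp [h]
  · exact (g.pos x v h).le

theorem metric_add_self_le
    (g : Bundle.ContMDiffRiemannianMetric 𝓘(ℝ, E) ∞ E (fun x : M => TangentSpace 𝓘(ℝ, E) x))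
    (x : M) (v w : TangentSpace 𝓘(ℝ, E) x) :
    g.inner x (v + w) (v + w) ≤ 2 * g.inner x v v + 2 * g.inner x w w := by
  have h := metric_self_nonneg g x (v - w)
  have hs := g.symm x v w
  simp only [map_add, map_sub, sub_apply, add_apply] at h ⊢
  linarith

theorem exists_sq_form_le_metric [CompactSpace M]
    (g : Bundle.ContMDiffRiemannianMetric 𝓘(ℝ, E) ∞ E (fun x : M => TangentSpace 𝓘(ℝ, E) x))
    {α : ∀ x : M, TangentSpace 𝓘(ℝ, E) x →L[ℝ] ℝ} (hα : IsSmoothOneForm α) :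
    ∃ K : ℝ, ∀ x v, (α x v) ^ 2 ≤ K * g.inner x v v := by
  have := (isCompact_univ (X := M)).induction_on
    (p := fun s => ∃ K : ℝ, ∀ x ∈ s, ∀ v, (α x v) ^ 2 ≤ K * g.inner x v v) ⟨0, by simp⟩
    (fun s t hst ⟨K, hK⟩ => ⟨K, fun x hx => hK x (hst hx)⟩)
    (fun s t ⟨K, hK⟩ ⟨K', hK'⟩ => ⟨max K K', fun x hx v => by
      have h0 := metric_self_nonneg g x v
      rcases hx with hx | hx
      · exact (hK x hx v).trans (by gcongr; exact le_max_left _ _)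
      · exact (hK' x hx v).trans (by gcongr; exact le_max_right _ _)⟩)
    (fun x _ => by
      obtain ⟨K, hK⟩ := exists_eventually_sq_form_le_metric g hα x
      exact ⟨_, mem_nhdsWithin_of_mem_nhds hK, K, fun y hy => hy⟩)
  obtain ⟨K, hK⟩ := this
  exact ⟨K, fun x => hK x trivial⟩

theorem exists_metric_section_le [CompactSpace M]
    (g : Bundle.ContMDiffRiemannianMetric 𝓘(ℝ, E) ∞ E (fun x : M => TangentSpace 𝓘(ℝ, E) x))
    {v : ∀ x : M, TangentSpace 𝓘(ℝ, E) x}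
    (hv : ContMDiff 𝓘(ℝ, E) (𝓘(ℝ, E).prod 𝓘(ℝ, E)) ∞
      (fun x => Bundle.TotalSpace.mk' E (E := fun x : M => TangentSpace 𝓘(ℝ, E) x) x (v x))) :
    ∃ K : ℝ, ∀ x, g.inner x (v x) (v x) ≤ K := by
  have h1 : IsSmoothOneForm (fun x => g.inner x (v x)) :=
    ContMDiff.clm_bundle_apply (b := id) (F₂ := E →L[ℝ] ℝ)
      (E₂ := fun x : M => TangentSpace 𝓘(ℝ, E) x →L[ℝ] ℝ) (ϕ := fun x => g.inner x) g.contMDiff hv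
  have h2 := (h1.contMDiff_apply hv).continuous
  obtain ⟨K, hK⟩ := (isCompact_range h2).bddAbove
  exact ⟨K, fun x => hK ⟨x, rfl⟩⟩

end MetricBounds

/-! ### Derivatives of flows and of time changes -/

section FlowCalculus

variable {E : Type*} [NormedAddCommGroup E] [NormedSpace ℝ E]
  {M : Type*} [TopologicalSpace M] [ChartedSpace E M]

variable (E) in
/-- The generator of a flow, as a vector of the model space. -/
def flowVelocity (X : Flow ℝ M) (x : M) : E := flowGenerator E X x

variable (E) in
/-- The derivative of a flow in space, as an operator of the model space. -/
def flowJacobian (X : Flow ℝ M) (t : ℝ) (x : M) : E →L[ℝ] E := flowDeriv E X t x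

/-- The value of a 1-form at a point, as a functional on the model space. -/
def formAt (α : ∀ x : M, TangentSpace 𝓘(ℝ, E) x →L[ℝ] ℝ) (x : M) : E →L[ℝ] ℝ := α x

theorem map_eq_smul_one {F : Type*} [NormedAddCommGroup F] [NormedSpace ℝ F] (L : ℝ →L[ℝ] F)
    (r : ℝ) : L r = r • L 1 := by
  rw [← L.map_smul, smul_eq_mul, mul_one]

/-- By the group law `X^s(x) = X^{s-t}(X^t(x))`, the derivative at time `t` is the derivative at
time `0` from the point `X^t(x)`. -/
theorem IsSmoothFlow.mfderiv_time {X : Flow ℝ M} (hX : IsSmoothFlow E X) (t r : ℝ) (x : M) :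
    (mfderiv 𝓘(ℝ, ℝ) 𝓘(ℝ, E) (fun t : ℝ => X t x) t : ℝ →L[ℝ] E) r
      = r • flowVelocity E X (X t x) := by
  have h1 : (fun s : ℝ => X s x) = (fun s : ℝ => X s (X t x)) ∘ (fun s : ℝ => s - t) := by
    ext s
    simp [← X.map_add]
  have h2 : HasMFDerivAt 𝓘(ℝ, ℝ) 𝓘(ℝ, ℝ) (fun s : ℝ => s - t) t (ContinuousLinearMap.id ℝ ℝ) :=
    ((hasFDerivAt_id t).sub_const t).hasMFDerivAt
  have h3 : HasMFDerivAt 𝓘(ℝ, ℝ) 𝓘(ℝ, E) (fun s : ℝ => X s (X t x)) (t - t)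
      (mfderiv 𝓘(ℝ, ℝ) 𝓘(ℝ, E) (fun s : ℝ => X s (X t x)) (t - t)) :=
    ((hX.contMDiff_time (X t x)).mdifferentiable (by simp) _).hasMFDerivAt
  have h4 := (HasMFDerivAt.comp (f := fun s : ℝ => s - t) t h3 h2).mfderiv
  rw [← h1] at h4
  have h5 : (mfderiv 𝓘(ℝ, ℝ) 𝓘(ℝ, E) (fun s : ℝ => X s x) t : ℝ →L[ℝ] E)
      = (mfderiv 𝓘(ℝ, ℝ) 𝓘(ℝ, E) (fun s : ℝ => X s (X t x)) 0 : ℝ →L[ℝ] E) := by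
    refine h4.trans ?_
    rw [sub_self]
    rfl
  rw [h5]
  exact map_eq_smul_one (F := E) (mfderiv 𝓘(ℝ, ℝ) 𝓘(ℝ, E) (fun s : ℝ => X s (X t x)) 0 : ℝ →L[ℝ] E) r

theorem IsSmoothFlow.flowJacobian_flowVelocity {X : Flow ℝ M} (hX : IsSmoothFlow E X)
    (t : ℝ) (x : M) :
    flowJacobian E X t x (flowVelocity E X x) = flowVelocity E X (X t x) := by
  have h1 : (fun s : ℝ => X s (X t x)) = (fun y : M => X t y) ∘ (fun s : ℝ => X s x) := by
    ext s
    simp [← X.map_add, add_comm]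
  have h0 : X 0 x = x := X.map_zero_apply x
  have h2 := mfderiv_comp_of_eq (x := (0 : ℝ)) (y := x)
    ((hX.contMDiff_space t).mdifferentiable (by simp) x)
    ((hX.contMDiff_time x).mdifferentiable (by simp) 0) h0
  rw [← h1] at h2
  have h3 : (mfderiv 𝓘(ℝ, ℝ) 𝓘(ℝ, E) (fun s : ℝ => X s (X t x)) 0 : ℝ →L[ℝ] E) 1
      = (mfderiv 𝓘(ℝ, E) 𝓘(ℝ, E) (fun y : M => X t y) (X 0 x) : E →L[ℝ] E)
        (flowVelocity E X x) := congrArg (fun L : ℝ →L[ℝ] E => L 1) h2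
  have h4 : (mfderiv 𝓘(ℝ, E) 𝓘(ℝ, E) (fun y : M => X t y) (X 0 x) : E →L[ℝ] E)
      = flowJacobian E X t x := congrArg (flowJacobian E X t) h0
  rw [h4] at h3
  exact h3.symm

theorem IsSmoothFlow.mfderiv_flow_graph {Y : Flow ℝ M} (hY : IsSmoothFlow E Y) {c : M → ℝ} {x : M}
    {c' : E →L[ℝ] ℝ} (hc : HasMFDerivAt 𝓘(ℝ, E) 𝓘(ℝ, ℝ) c x c') (v : E) :
    (mfderiv 𝓘(ℝ, E) 𝓘(ℝ, E) (fun z => Y (c z) z) x : E →L[ℝ] E) v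
      = c' v • flowVelocity E Y (Y (c x) x) + flowJacobian E Y (c x) x v := by
  have h1 : MDifferentiableAt (𝓘(ℝ, ℝ).prod 𝓘(ℝ, E)) 𝓘(ℝ, E) (fun q : ℝ × M => Y q.1 q.2)
    (c x, x) := hY.contMDiff.mdifferentiable (by simp) _
  have h2 := (HasMFDerivAt.comp (f := fun z => (c z, id z)) x h1.hasMFDerivAt
    (hc.prodMk (hasMFDerivAt_id x))).mfderiv
  have h3 := congrArg (fun L : E →L[ℝ] E => L v) h2
  refine h3.trans ?_
  have h4 := mfderiv_prod_eq_add_apply (v := (c' v, v)) h1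
  refine Eq.trans h4 ?_
  exact congrArg (· + flowJacobian E Y (c x) x v) (hY.mfderiv_time (c x) _ x)

/-- `Y` runs along the orbits of `X`: the `Y`-time along the piece of `X`-orbit from `x` to
`X^s(x)` is `s + A s x`, where the cocycle `A` is the integral along this piece of the closed
1-form `α`. -/
structure IsTimeChange (X Y : Flow ℝ M) (α : ∀ x : M, TangentSpace 𝓘(ℝ, E) x →L[ℝ] ℝ)
    (A : ℝ → M → ℝ) : Prop where
  flow_eq : ∀ s x, Y (s + A s x) x = X s x
  zero : ∀ x, A 0 x = 0
  primitive : ∀ s x, ∃ f₀ f₁ : M → ℝ, ContMDiff 𝓘(ℝ, E) 𝓘(ℝ, ℝ) ∞ f₀ ∧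
    ContMDiff 𝓘(ℝ, E) 𝓘(ℝ, ℝ) ∞ f₁ ∧ (∀ᶠ z in 𝓝 x, α z = differential f₀ z) ∧
    (∀ᶠ z in 𝓝 (X s x), α z = differential f₁ z) ∧
    ∀ᶠ q in 𝓝 (s, x), A q.1 q.2 = f₁ (X q.1 q.2) - f₀ q.2
  small : ∀ x, |formAt α x (flowVelocity E X x)| < 1 / 2
  exists_time : ∀ t x, ∃ s, s + A s x = t ∧ (0 ≤ t → 1 / 2 * t ≤ s) ∧ (t ≤ 0 → s ≤ 1 / 2 * t)

namespace IsTimeChange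

variable {X Y : Flow ℝ M} {α : ∀ x : M, TangentSpace 𝓘(ℝ, E) x →L[ℝ] ℝ} {A : ℝ → M → ℝ}
  (h : IsTimeChange X Y α A) (hX : IsSmoothFlow E X) (hY : IsSmoothFlow E Y)
include h

theorem isSmoothOneForm [IsManifold 𝓘(ℝ, E) ∞ M] : IsSmoothOneForm α := by
  refine IsSmoothOneForm.congr_of_eventuallyEq fun x => ?_
  obtain ⟨f₀, f₁, h₀, -, hα, -⟩ := h.primitive 0 x
  exact ⟨_, isSmoothOneForm_differential h₀, hα⟩

theorem one_add_pos (x : M) : 1 / 2 < 1 + formAt α x (flowVelocity E X x) := by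
  have := abs_lt.1 (h.small x)
  linarith

include hX hY

/-- Differentiate `Y^{s + A s x}(x) = X^s(x)` in `s` at `0`; the derivative of `A` there is `α(X)`.
-/
theorem flowVelocity_eq (x : M) :
    flowVelocity E X x = (1 + formAt α x (flowVelocity E X x)) • flowVelocity E Y x := by
  obtain ⟨f₀, f₁, h₀, h₁, hα, hα₁, hA⟩ := h.primitive 0 x
  have e0 : X 0 x = x := X.map_zero_apply x
  have hA' : ∀ᶠ s in 𝓝 (0 : ℝ), A s x = f₁ (X s x) - f₀ x :=
    (Continuous.prodMk_left x).continuousAt.eventually hA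
  have d1 : HasMFDerivAt 𝓘(ℝ, ℝ) 𝓘(ℝ, ℝ) (fun s : ℝ => f₁ (X s x)) 0
      ((formAt α x).comp (mfderiv 𝓘(ℝ, ℝ) 𝓘(ℝ, E) (fun s : ℝ => X s x) 0 : ℝ →L[ℝ] E)) := by
    have e1 := HasMFDerivAt.comp (f := fun s : ℝ => X s x) (0 : ℝ)
      ((h₁ (X 0 x)).mdifferentiableAt (by simp)).hasMFDerivAt
      ((hX.contMDiff_time x).mdifferentiable (by simp) 0).hasMFDerivAt
    have e2 : formAt α (X 0 x) = formAt (differential f₁) (X 0 x) := hα₁.self_of_nhds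
    have e3 : formAt α x = formAt (differential f₁) (X 0 x) := by
      rw [← e2, e0]
    rw [e3]
    exact e1
  have d3 : HasFDerivAt (fun s : ℝ => f₁ (X s x)) ((formAt α x).comp
      (mfderiv 𝓘(ℝ, ℝ) 𝓘(ℝ, E) (fun s : ℝ => X s x) 0 : ℝ →L[ℝ] E)) (0 : ℝ) :=
    hasMFDerivAt_iff_hasFDerivAt.1 d1
  have d3 : HasDerivAt (fun s : ℝ => f₁ (X s x)) (formAt α x (flowVelocity E X x)) 0 :=
    d3.hasDerivAt
  have d2 : HasDerivAt (fun s : ℝ => s + A s x) (1 + formAt α x (flowVelocity E X x)) 0 := by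
    refine ((hasDerivAt_id (0 : ℝ)).add (d3.sub_const (f₀ x))).congr_of_eventuallyEq ?_
    filter_upwards [hA'] with s hs
    simp [hs]
  have e1 : (fun s : ℝ => X s x) = (fun t : ℝ => Y t x) ∘ (fun s : ℝ => s + A s x) := by
    ext s
    exact (h.flow_eq s x).symm
  have d7 := d2.hasFDerivAt.hasMFDerivAt
  have d4 := mfderiv_comp_of_eq (x := (0 : ℝ)) (y := (0 : ℝ))
    ((hY.contMDiff_time x).mdifferentiable (by simp) 0) d7.mdifferentiableAt (by simp [h.zero])
  rw [← e1, d7.mfderiv] at d4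
  have e3 : (0 : ℝ) + A 0 x = 0 := by simp [h.zero]
  have d6 := hY.mfderiv_time 0 (1 + formAt α x (flowVelocity E X x)) x
  rw [Y.map_zero_apply] at d6
  rw [← d6]
  have d5 : flowVelocity E X x =
      (mfderiv 𝓘(ℝ, ℝ) 𝓘(ℝ, E) (fun t : ℝ => Y t x) (0 + A 0 x) : ℝ →L[ℝ] E)
        ((1 : ℝ) • (1 + formAt α x (flowVelocity E X x) : ℝ) : ℝ) :=
    congrArg (fun L : ℝ →L[ℝ] E => L 1) d4
  rw [one_smul, e3] at d5
  exact d5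

/-- Differentiate the same relation in `x` with `s` fixed: the differential of `A s` is the
pull-back of `α` by `X^s` minus `α`, since `A` is a difference of primitives at the two ends. -/
theorem flowJacobian_eq (s : ℝ) (x : M) (v : E) :
    flowJacobian E X s x v =
      (formAt α (X s x) (flowJacobian E X s x v) - formAt α x v) • flowVelocity E Y (X s x)
        + flowJacobian E Y (s + A s x) x v := by
  obtain ⟨f₀, f₁, h₀, h₁, hα, hα₁, hA⟩ := h.primitive s x
  have hA' : ∀ᶠ z in 𝓝 x, A s z = f₁ (X s z) - f₀ z :=
    (Continuous.prodMk_right s).continuousAt.eventually hA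
  have d1 := HasMFDerivAt.comp (f := fun z => X s z) x
      ((h₁ (X s x)).mdifferentiableAt (by simp)).hasMFDerivAt
      ((hX.contMDiff_space s).mdifferentiable (by simp) x).hasMFDerivAt
  have d0 := ((h₀ x).mdifferentiableAt (by simp)).hasMFDerivAt
  have d2 : HasMFDerivAt 𝓘(ℝ, E) 𝓘(ℝ, ℝ) (fun z => s + A s z) x
      ((formAt α (X s x)).comp (flowJacobian E X s x) - formAt α x) := by
    have d3 := (hasMFDerivAt_const (I := 𝓘(ℝ, E)) (I' := 𝓘(ℝ, ℝ)) s x).add (d1.sub d0)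
    have e1 : formAt α (X s x) = formAt (differential f₁) (X s x) := hα₁.self_of_nhds
    have e2 : formAt α x = formAt (differential f₀) x := hα.self_of_nhds
    rw [e1, e2]
    refine (d3.congr_mfderiv ?_).congr_of_eventuallyEq ?_
    · exact zero_add _
    · filter_upwards [hA'] with z hz
      simp [hz]
  have d3 := hY.mfderiv_flow_graph d2 v
  have e1 : (fun z => Y (s + A s z) z) = fun z => X s z := by
    ext z
    exact h.flow_eq s z
  rw [e1, h.flow_eq] at d3
  exact d3

end IsTimeChange

end FlowCalculus

/-! ### Anosov and contact flows under a time change -/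

section AnosovContact

variable {E : Type*} [NormedAddCommGroup E] [NormedSpace ℝ E]
  {M : Type*} [TopologicalSpace M] [ChartedSpace E M]

/-- The map `v ↦ v + a(v) u`, with `1 + a(u) ≠ 0`, as a linear equivalence. -/
def shearEquiv (a : E →L[ℝ] ℝ) (u : E) (hu : 1 + a u ≠ 0) : E ≃ₗ[ℝ] E where
  toFun v := v + a v • u
  map_add' v w := by simp only [map_add, add_smul]; abel
  map_smul' c v := by simp [smul_smul]
  invFun w := w - (a w / (1 + a u)) • u
  left_inv v := by
    have : a v + a v * a u = a v * (1 + a u) := by ring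
    simp [this, hu]
  right_inv w := by
    have : a w - a w / (1 + a u) * a u = a w / (1 + a u) := by field_simp; ring
    simp [this]

theorem isInternal_comap (e : E ≃ₗ[ℝ] E) {V W : Fin 3 → Submodule ℝ E}
    (hV : DirectSum.IsInternal V) (h : ∀ i, W i = (V i).comap (e : E →ₗ[ℝ] E)) :
    DirectSum.IsInternal W := by
  rw [DirectSum.isInternal_submodule_iff_iSupIndep_and_iSup_eq_top] at hV ⊢
  have hW : W = (Submodule.orderIsoMapComap e.symm) ∘ V := by
    ext1 i
    rw [h]
    simp [Submodule.orderIsoMapComap_apply, Submodule.map_equiv_eq_comap_symm]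
  rw [hW]
  refine ⟨iSupIndep_map_orderIso_iff _ |>.2 hV.1, ?_⟩
  rw [← map_top (Submodule.orderIsoMapComap e.symm), ← hV.2, OrderIso.map_iSup]
  rfl

namespace IsTimeChange

variable {X Y : Flow ℝ M} {α : ∀ x : M, TangentSpace 𝓘(ℝ, E) x →L[ℝ] ℝ} {A : ℝ → M → ℝ}
  (h : IsTimeChange X Y α A) (hX : IsSmoothFlow E X) (hY : IsSmoothFlow E Y)

/-- The bundle map `v ↦ v + α(v) X`, which intertwines the derivatives of `Y` and `X`. -/
def shear (h : IsTimeChange X Y α A) (x : M) : E ≃ₗ[ℝ] E :=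
  shearEquiv (formAt α x) (flowVelocity E X x) (by have := h.one_add_pos x; linarith)

theorem shear_apply (x : M) (v : E) :
    h.shear x v = v + formAt α x v • flowVelocity E X x := rfl

include h hX hY

/-- With `a = α(X)` and `X = (1 + a) Y` one has `α(Y) X = a Y`, so `Y + α(Y) X = (1 + a) Y = X`. -/
theorem shear_flowVelocity (x : M) : h.shear x (flowVelocity E Y x) = flowVelocity E X x := by
  have h1 := h.flowVelocity_eq hX hY x
  have h2 := h.one_add_pos x
  set a := formAt α x (flowVelocity E X x) with ha
  have h3 : a = (1 + a) * formAt α x (flowVelocity E Y x) := by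
    conv_lhs => rw [ha, h1, map_smul, smul_eq_mul]
  have h4 : formAt α x (flowVelocity E Y x) * (1 + a) + 1 = 1 + a := by linarith
  rw [shear_apply]
  conv_rhs => rw [h1, ← h4, add_smul, one_smul, mul_smul, ← h1, add_comm]

/-- Applying the bundle map to `flowJacobian_eq`, the terms in `α(DX^s v)` cancel and `DX^s v + α(v)
X` is left, which is `DX^s (v + α(v) X)` because the flow preserves its generator. -/
theorem shear_flowJacobian (s : ℝ) (x : M) (v : E) :
    h.shear (X s x) (flowJacobian E Y (s + A s x) x v) = flowJacobian E X s x (h.shear x v) := by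
  have h1 := h.flowJacobian_eq hX hY s x v
  have h2 := congrArg (h.shear (X s x)) h1
  rw [map_add, map_smul, h.shear_flowVelocity hX hY] at h2
  rw [shear_apply (v := v), map_add, map_smul, hX.flowJacobian_flowVelocity]
  rw [shear_apply (v := flowJacobian E X s x v)] at h2
  have h3 := sub_eq_of_eq_add' h2
  rw [← h3, sub_smul]
  abel

omit hX hY in
theorem metric_shear_le [IsManifold 𝓘(ℝ, E) ∞ M] [CompactSpace M] (hX : IsSmoothFlow E X)
    (g : Bundle.ContMDiffRiemannianMetric 𝓘(ℝ, E) ∞ E (fun x : M => TangentSpace 𝓘(ℝ, E) x)) :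
    ∃ K : ℝ, 0 < K ∧ ∀ x (v : E), metricNorm g (x := x) (h.shear x v) ≤ K * metricNorm g (x := x) v ∧
      metricNorm g (x := x) v ≤ K * metricNorm g (x := x) (h.shear x v) := by
  obtain ⟨K₁, hK₁⟩ := exists_sq_form_le_metric g h.isSmoothOneForm
  obtain ⟨K₂, hK₂⟩ := exists_metric_section_le g hX.contMDiff_flowGenerator
  -- The shear and its inverse both have the form `v ↦ v + c X` with `c² ≤ 4 α(v)²`: for the
  -- inverse, `c = -α(v) / (1 + α(X))` with `1 + α(X) > 1/2`. Then `metric_add_self_le` bounds the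
  -- square of the new length by `2 + 2 · 4 |K₁| |K₂|` times the old one.
  set K := 2 + 8 * |K₁| * |K₂| with hK
  have hK0 : 0 < K := by positivity
  have key : ∀ x (v : E) (c : ℝ), c ^ 2 ≤ 4 * formAt α x v ^ 2 →
      metricNorm g (x := x) (v + c • flowVelocity E X x) ≤ √K * metricNorm g (x := x) v := by
    intro x v c hc
    unfold metricNorm
    rw [← Real.sqrt_mul hK0.le]
    refine Real.sqrt_le_sqrt ?_
    have h1 := metric_add_self_le g x v (c • flowVelocity E X x)
    have h2 : g.inner x (c • flowVelocity E X x) (c • flowVelocity E X x)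
        = c ^ 2 * g.inner x (flowVelocity E X x) (flowVelocity E X x) := by
      have h3 : ∀ (G : E →L[ℝ] E →L[ℝ] ℝ) (u : E), G (c • u) (c • u) = c ^ 2 * G u u := by
        intro G u
        simp only [map_smul, smul_apply, smul_eq_mul]
        ring
      exact h3 (g.inner x) _
    have h3 := metric_self_nonneg g x v
    have h4 := metric_self_nonneg g x (flowVelocity E X x)
    have h5 : formAt α x v ^ 2 ≤ |K₁| * g.inner x v v :=
      (hK₁ x v).trans (by gcongr; exact le_abs_self _)
    have h6 : g.inner x (flowVelocity E X x) (flowVelocity E X x) ≤ |K₂| :=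
      (hK₂ x).trans (le_abs_self _)
    have h7 : c ^ 2 * g.inner x (flowVelocity E X x) (flowVelocity E X x)
        ≤ (4 * (|K₁| * g.inner x v v)) * |K₂| := by
      gcongr
      exact hc.trans (by gcongr)
    rw [h2] at h1
    calc _ ≤ _ := h1
      _ ≤ 2 * g.inner x v v + 2 * ((4 * (|K₁| * g.inner x v v)) * |K₂|) := by gcongr
      _ = _ := by rw [hK]; ring
  refine ⟨√K, Real.sqrt_pos.2 hK0, fun x v => ⟨key x v _ (by nlinarith [sq_nonneg (formAt α x v)]), ?_⟩⟩
  have h1 := (h.shear x).symm_apply_apply v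
  have h2 := key x (h.shear x v) (-(formAt α x (h.shear x v) / (1 + formAt α x (flowVelocity E X x)))) (by
    have := h.one_add_pos x
    rw [neg_sq, div_pow, div_le_iff₀ (by positivity)]
    have h3 : 1 ≤ 4 * (1 + formAt α x (flowVelocity E X x)) ^ 2 := by nlinarith
    nlinarith [mul_le_mul_of_nonneg_left h3 (sq_nonneg (formAt α x (h.shear x v)))])
  rw [neg_smul, ← sub_eq_add_neg] at h2
  exact (congrArg (fun w : E => metricNorm g (x := x) w) h1).symm.le.trans h2

theorem map_comap_shear {V : ∀ _ : M, Submodule ℝ E} {s : ℝ} {x : M}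
    (hV : (V x).map (flowJacobian E X s x).toLinearMap = V (X s x)) :
    ((V x).comap (h.shear x : E →ₗ[ℝ] E)).map (flowJacobian E Y (s + A s x) x).toLinearMap
      = (V (X s x)).comap (h.shear (X s x) : E →ₗ[ℝ] E) := by
  ext u
  simp only [Submodule.mem_map, Submodule.mem_comap, LinearEquiv.coe_coe,
    ContinuousLinearMap.coe_coe]
  constructor
  · rintro ⟨w, hw, rfl⟩
    rw [h.shear_flowJacobian hX hY, ← hV]
    exact Submodule.mem_map_of_mem hw
  · intro hu
    rw [← hV] at hu
    obtain ⟨w, hw, hwu⟩ := hu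
    refine ⟨(h.shear x).symm w, by simpa using hw, (h.shear (X s x)).injective ?_⟩
    rw [h.shear_flowJacobian hX hY, LinearEquiv.apply_symm_apply]
    exact hwu

theorem isAnosovFlow [IsManifold 𝓘(ℝ, E) ∞ M] [CompactSpace M] (hXA : IsAnosovFlow E X) :
    IsAnosovFlow E Y := by
  obtain ⟨g, Es, Eu, C, lam, hC, hlam, h0, hsplit, hs, hu, hsc, huc⟩ := hXA
  obtain ⟨K, hK, hgK⟩ := h.metric_shear_le hX g
  -- Absolute values of the times let one estimate serve `E^s` in positive and `E^u` in negative
  -- time. Two passages through the shear cost `K²`, and `|s| ≥ |t| / 2` halves the rate.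
  have contr : ∀ (V : ∀ x : M, Submodule ℝ E) (t s : ℝ) (x : M) (v : E),
      (V x).map (flowJacobian E X s x).toLinearMap = V (X s x) → s + A s x = t → 1 / 2 * |t| ≤ |s| →
      metricNorm g (x := X s x) (flowJacobian E X s x (h.shear x v))
        ≤ C * Real.exp (-lam * |s|) * metricNorm g (x := x) (h.shear x v) →
      metricNorm g (x := Y t x) (flowJacobian E Y t x v)
        ≤ K ^ 2 * C * Real.exp (-(lam / 2) * |t|) * metricNorm g (x := x) v := by
    rintro V t s x v hV rfl hts hc
    rw [h.flow_eq]
    calc _ ≤ K * metricNorm g (x := X s x)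
            (h.shear (X s x) (flowJacobian E Y (s + A s x) x v)) := (hgK _ _).2
      _ = K * metricNorm g (x := X s x) (flowJacobian E X s x (h.shear x v)) := by
        rw [h.shear_flowJacobian hX hY]
      _ ≤ K * (C * Real.exp (-lam * |s|) * metricNorm g (x := x) (h.shear x v)) := by gcongr
      _ ≤ K * (C * Real.exp (-(lam / 2) * |s + A s x|) * (K * metricNorm g (x := x) v)) := by
        gcongr K * (C * Real.exp ?_ * ?_)
        · exact Real.sqrt_nonneg _
        · nlinarith
        · exact (hgK _ _).1
      _ = _ := by ring
  refine ⟨g, fun x => (Es x : Submodule ℝ E).comap (h.shear x : E →ₗ[ℝ] E),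
    fun x => (Eu x : Submodule ℝ E).comap (h.shear x : E →ₗ[ℝ] E), K ^ 2 * C, lam / 2,
    by positivity, by positivity, fun x hx => h0 x ?_, fun x => ?_, fun t x => ?_, fun t x => ?_,
    fun t ht x v hv => ?_, fun t ht x v hv => ?_⟩
  · have h1 := h.shear_flowVelocity hX hY x
    have h2 : flowVelocity E Y x = 0 := hx
    rw [h2, map_zero] at h1
    exact h1.symm
  · refine isInternal_comap (h.shear x) (hsplit x) fun i => ?_
    fin_cases i
    · rfl
    · have h1 : Submodule.span ℝ {flowVelocity E Y x}
        = (Submodule.span ℝ {flowVelocity E X x}).comap (h.shear x : E →ₗ[ℝ] E) := by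
        ext u
        rw [← h.shear_flowVelocity hX hY, Submodule.mem_comap, Submodule.mem_span_singleton,
          Submodule.mem_span_singleton]
        simp only [LinearEquiv.coe_coe, ← map_smul, (h.shear x).injective.eq_iff]
      exact h1
    · rfl
  · obtain ⟨s, rfl, -⟩ := h.exists_time t x
    have h1 := h.map_comap_shear hX hY (V := Es) (hs s x)
    refine h1.trans ?_
    exact congrArg (fun z : M => (Es z : Submodule ℝ E).comap (h.shear z : E →ₗ[ℝ] E))
      (h.flow_eq s x).symm
  · obtain ⟨s, rfl, -⟩ := h.exists_time t x
    have h1 := h.map_comap_shear hX hY (V := Eu) (hu s x)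
    refine h1.trans ?_
    exact congrArg (fun z : M => (Eu z : Submodule ℝ E).comap (h.shear z : E →ₗ[ℝ] E))
      (h.flow_eq s x).symm
  · obtain ⟨s, hst, hpos, -⟩ := h.exists_time t x
    have hts := hpos ht
    have hs0 : 0 ≤ s := by linarith
    have := contr Es t s x v (hs s x) hst (by rwa [abs_of_nonneg ht, abs_of_nonneg hs0]) (by
      rw [abs_of_nonneg hs0]; exact hsc s hs0 x _ hv)
    rwa [abs_of_nonneg ht] at this
  · obtain ⟨s, hst, -, hneg⟩ := h.exists_time (-t) x
    have hts := hneg (by linarith)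
    have hs0 : s ≤ 0 := by linarith
    have := contr Eu (-t) s x v (hu s x) hst
      (by rw [abs_neg, abs_of_nonneg ht, abs_of_nonpos hs0]; linarith) (by
      rw [abs_of_nonpos hs0]
      have := huc (-s) (by linarith) x _ hv
      rw [neg_neg] at this
      exact this)
    rwa [abs_neg, abs_of_nonneg ht] at this

theorem isContactFlow [IsManifold 𝓘(ℝ, E) ∞ M] (hXC : IsContactFlow E X) : IsContactFlow E Y := by
  obtain ⟨β, ⟨hβ, k, hk, hvol⟩, h1, h0⟩ := hXC
  have hd : ∀ x (v w : E), oneFormExtDeriv (fun x => β x + α x) x v w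
      = oneFormExtDeriv β x v w := by
    intro x v w
    obtain ⟨f₀, -, hf₀, -, hα, -⟩ := h.primitive 0 x
    exact oneFormExtDeriv_add_closed hβ hf₀ hα v w
  have hanti : ∀ x (v w : E), oneFormExtDeriv β x v w = - oneFormExtDeriv β x w v := by
    intro x v w
    simp only [oneFormExtDeriv]
    ring
  have hlin : ∀ x (u v w : E) (c : ℝ), oneFormExtDeriv β x (v + c • u) w
      = oneFormExtDeriv β x v w + c * oneFormExtDeriv β x u w := by
    intro x u v w c
    have h2 : ∀ (dB : E →L[ℝ] E →L[ℝ] ℝ) (D : E →L[ℝ] E),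
        dB (D (v + c • u)) (D w) - dB (D w) (D (v + c • u))
          = (dB (D v) (D w) - dB (D w) (D v)) + c * (dB (D u) (D w) - dB (D w) (D u)) := by
      intro dB D
      simp only [map_add, map_smul, add_apply, smul_apply, smul_eq_mul]
      ring
    exact h2 _ _
  have h0' : ∀ x (v : E), oneFormExtDeriv β x (flowVelocity E X x) v = 0 := h0
  -- The shear adds multiples of the Reeb field, which lies in the kernel of `dβ`.
  have hsh : ∀ x (v w : E), oneFormExtDeriv β x (h.shear x v) (h.shear x w)
      = oneFormExtDeriv β x v w := by
    intro x v w
    rw [shear_apply, hlin, h0', mul_zero, add_zero, hanti, shear_apply, hlin, h0', mul_zero,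
      add_zero, ← hanti]
  have hβsh : ∀ x (v : E), formAt β x (h.shear x v) = formAt β x v + formAt α x v := by
    intro x v
    have h2 : formAt β x (flowVelocity E X x) = 1 := h1 x
    rw [shear_apply, map_add, map_smul, h2, smul_eq_mul, mul_one]
  refine ⟨fun x => β x + α x, ⟨hβ.add h.isSmoothOneForm, k, hk, fun x => ?_⟩, fun x => ?_,
    fun x v => ?_⟩
  · obtain ⟨v, hv⟩ := hvol x
    -- The contact volume of `β + α` is the pull-back by the shear of that of `β`, so a frame with
    -- nonzero volume is pulled back.
    refine ⟨fun i => (h.shear x).symm (v i), fun hz => hv (Eq.trans ?_ hz)⟩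
    have hinv : ∀ w : E, h.shear x ((h.shear x).symm w) = w := (h.shear x).apply_symm_apply
    refine Finset.sum_congr rfl fun σ _ => ?_
    refine congrArg₂ (· * ·) rfl (congrArg₂ (· * ·) ?_
      (Finset.prod_congr rfl fun i _ => ?_))
    · exact (congrArg (formAt β x) (hinv _)).symm.trans (hβsh x _)
    · refine Eq.trans ?_ (hd x _ _).symm
      refine Eq.trans ?_ (hsh x _ _)
      exact congrArg₂ (fun a b : E => oneFormExtDeriv β x a b) (hinv _).symm (hinv _).symm
  · have h2 := hβsh x (flowVelocity E Y x)
    rw [h.shear_flowVelocity hX hY] at h2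
    exact h2.symm.trans (h1 x)
  · have h3 := hsh x (flowVelocity E Y x) v
    rw [h.shear_flowVelocity hX hY, h0'] at h3
    exact (hd x _ _).trans h3.symm

end IsTimeChange

end AnosovContact

/-! ### Homology classes of paths -/

section PathClass

open CategoryTheory

variable {M : Type*} [TopologicalSpace M] [PathConnectedSpace M]

/-- The arrow of the fundamental groupoid from `x` to the base point used by `freeLoopClass`. -/
def toBase (x₀ x : M) : FundamentalGroupoid.mk x ⟶ FundamentalGroupoid.mk x₀ :=
  Path.Homotopic.Quotient.mk (PathConnectedSpace.somePath x x₀)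

/-- The class in `H₁` of an arrow of the fundamental groupoid, closed up through the base point. -/
def arrowClass (x₀ : M) {x y : M} (a : FundamentalGroupoid.mk x ⟶ FundamentalGroupoid.mk y) :
    FirstHomology x₀ :=
  Additive.ofMul (Abelianization.of (show FundamentalGroup M x₀ from
    inv (toBase x₀ x) ≫ a ≫ toBase x₀ y))

theorem arrowClass_comp (x₀ : M) {x y z : M}
    (a : FundamentalGroupoid.mk x ⟶ FundamentalGroupoid.mk y)
    (b : FundamentalGroupoid.mk y ⟶ FundamentalGroupoid.mk z) :
    arrowClass x₀ (a ≫ b) = arrowClass x₀ a + arrowClass x₀ b := by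
  have h : inv (toBase x₀ x) ≫ (a ≫ b) ≫ toBase x₀ z
      = (inv (toBase x₀ x) ≫ a ≫ toBase x₀ y) ≫ (inv (toBase x₀ y) ≫ b ≫ toBase x₀ z) := by
    simp
  -- The product of `FundamentalGroup` composes in the opposite order; commutativity of the
  -- abelianization absorbs this.
  have h2 : (show FundamentalGroup M x₀ from inv (toBase x₀ x) ≫ (a ≫ b) ≫ toBase x₀ z)
      = (show FundamentalGroup M x₀ from inv (toBase x₀ y) ≫ b ≫ toBase x₀ z) *
        (show FundamentalGroup M x₀ from inv (toBase x₀ x) ≫ a ≫ toBase x₀ y) := h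
  unfold arrowClass
  rw [h2, map_mul, ofMul_mul, add_comm]

/-- The class in `H₁` of a path, closed up through the base point. -/
def pathClass (x₀ : M) {x y : M} (c : Path x y) : FirstHomology x₀ :=
  arrowClass x₀ (show FundamentalGroupoid.mk x ⟶ FundamentalGroupoid.mk y from
    Path.Homotopic.Quotient.mk c)

theorem pathClass_trans (x₀ : M) {x y z : M} (c : Path x y) (d : Path y z) :
    pathClass x₀ (c.trans d) = pathClass x₀ c + pathClass x₀ d :=
  arrowClass_comp x₀
    (show FundamentalGroupoid.mk x ⟶ FundamentalGroupoid.mk y from Path.Homotopic.Quotient.mk c)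
    (show FundamentalGroupoid.mk y ⟶ FundamentalGroupoid.mk z from Path.Homotopic.Quotient.mk d)

theorem pathClass_congr (x₀ : M) {x y x' y' : M} (c : Path x y) (d : Path x' y')
    (h : ∀ t, c t = d t) : pathClass x₀ c = pathClass x₀ d := by
  obtain rfl : x = x' := by simpa using h 0
  obtain rfl : y = y' := by simpa using h 1
  obtain rfl : c = d := by ext t; exact h t
  rfl

theorem pathClass_refl (x₀ x : M) : pathClass x₀ (Path.refl x) = 0 := by
  have h : pathClass x₀ (Path.refl x) = pathClass x₀ (Path.refl x) + pathClass x₀ (Path.refl x) := by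
    rw [← pathClass_trans]
    refine pathClass_congr _ _ _ fun t => ?_
    simp
  simpa using h

theorem pathClass_symm (x₀ : M) {x y : M} (c : Path x y) :
    pathClass x₀ c.symm = - pathClass x₀ c := by
  rw [eq_neg_iff_add_eq_zero, ← pathClass_trans, ← pathClass_refl x₀ y]
  have : (Path.Homotopic.Quotient.mk (c.symm.trans c) : Path.Homotopic.Quotient y y)
    = Path.Homotopic.Quotient.mk (Path.refl y) :=
    Quotient.sound ⟨(Path.Homotopy.reflSymmTrans c).symm⟩
  exact congrArg (fun a => arrowClass x₀ (show FundamentalGroupoid.mk y ⟶ FundamentalGroupoid.mk y from a)) this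

theorem freeLoopClass_eq_pathClass (x₀ : M) {x : M} (ℓ : Path x x) :
    freeLoopClass x₀ ℓ = pathClass x₀ ℓ := by
  unfold pathClass arrowClass freeLoopClass
  refine congrArg (fun a : FundamentalGroup M x₀ => Additive.ofMul (Abelianization.of a)) ?_
  rw [← CategoryTheory.Groupoid.inv_eq_inv]
  rfl

/-- The chosen path from `x₀` to itself need not be constant, but conjugation by it is invisible in
the abelianization. -/
theorem basedLoopClass_eq_pathClass (x₀ : M) (ℓ : Path x₀ x₀) :
    basedLoopClass x₀ ℓ = pathClass x₀ ℓ := by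
  let q : FundamentalGroup M x₀ := toBase x₀ x₀
  have h2 : (show FundamentalGroup M x₀ from inv (toBase x₀ x₀) ≫
      (show FundamentalGroupoid.mk x₀ ⟶ FundamentalGroupoid.mk x₀ from
        Path.Homotopic.Quotient.mk ℓ) ≫ toBase x₀ x₀)
      = q * FundamentalGroup.fromPath (Path.Homotopic.Quotient.mk ℓ) * q⁻¹ := by
    rw [← CategoryTheory.Groupoid.inv_eq_inv]
    exact (Category.assoc _ _ _).symm.trans (Category.assoc _ _ _)
  unfold pathClass arrowClass basedLoopClass
  refine Eq.trans ?_ (congrArg (fun a : FundamentalGroup M x₀ =>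
    Additive.ofMul (Abelianization.of a)) h2).symm
  simp only [map_mul, map_inv, mul_inv_cancel_comm]

theorem freeLoopClass_eq_zero_of_mem_commutator (x₀ : M) {x : M} (ℓ : Path x x)
    (h : FundamentalGroup.fromPath (Path.Homotopic.Quotient.mk ℓ)
      ∈ commutator (FundamentalGroup M x)) : freeLoopClass x₀ ℓ = 0 := by
  have := Abelianization.commutator_subset_ker (Abelianization.of.comp
    (FundamentalGroup.fundamentalGroupMulEquivOfPath
      (PathConnectedSpace.somePath x x₀)).toMonoidHom) h
  exact this

end PathClass

/-! ### Deck transformations of the universal abelian cover -/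

section Cover

variable {M M' : Type*} [TopologicalSpace M] [TopologicalSpace M'] [PathConnectedSpace M]
  [PathConnectedSpace M'] {p : C(M', M)}

theorem IsCoveringMap.surjective_of_pathConnected (hp : IsCoveringMap p) : Function.Surjective p := by
  intro x
  obtain ⟨y⟩ : Nonempty M' := inferInstance
  obtain ⟨Γ, hΓ, -⟩ := hp.exists_path_lifts (PathConnectedSpace.somePath (p y) x).toContinuousMap y (by simp)
  refine ⟨Γ 1, ?_⟩
  have := congrFun hΓ 1
  simpa using this

omit [PathConnectedSpace M] [PathConnectedSpace M'] in
theorem range_mapOfEq {x : M} {z : M'} (h : p z = x)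
    (hr : (FundamentalGroup.map p z).range = commutator (FundamentalGroup M (p z))) :
    (FundamentalGroup.mapOfEq p h).range = commutator (FundamentalGroup M x) := by
  subst h
  rw [← hr]
  congr 1
  ext a
  rw [FundamentalGroup.mapOfEq_apply]
  exact Path.Homotopic.Quotient.cast_rfl_rfl _

omit [PathConnectedSpace M] in
theorem deckGroup_ext (hp : IsCoveringMap p) {g h : deckGroup p} {y : M'} (hy : g.1 y = h.1 y) :
    g = h := by
  ext z
  refine congrFun (hp.eq_of_comp_eq g.1.continuous h.1.continuous ?_ y hy) z
  ext z
  exact (g.2 z).trans (h.2 z).symm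

omit [PathConnectedSpace M] in
-- The commutator subgroup is normal, so the image of the fundamental group is the same subgroup for
-- every point of a fibre. The lifting criterion gives lifts of `p` in both directions, and they are
-- mutually inverse by uniqueness of lifts.
theorem exists_deck [LocallyPathConnectedSpace M'] (hp : IsCoveringMap p)
    (hr : ∀ y : M', (FundamentalGroup.map p y).range = commutator (FundamentalGroup M (p y)))
    {y z : M'} (h : p y = p z) : ∃ g : deckGroup p, g.1 y = z := by
  obtain ⟨F, ⟨hF, hpF⟩, -⟩ := hp.existsUnique_continuousMap_lifts_of_range_le (f := p) (a₀ := y) (e₀ := z)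
    h.symm (by rw [hr]; exact (range_mapOfEq (p := p) h.symm (hr z)).ge)
  obtain ⟨G, ⟨hG, hpG⟩, -⟩ := hp.existsUnique_continuousMap_lifts_of_range_le (f := p) (a₀ := z) (e₀ := y)
    h (by rw [hr]; exact (range_mapOfEq (p := p) h (hr y)).ge)
  have hGF : G ∘ F = id := hp.eq_of_comp_eq (G.continuous.comp F.continuous) continuous_id
    (by rw [← Function.comp_assoc, hpG, hpF]; rfl) y (by simp [hF, hG])
  have hFG : F ∘ G = id := hp.eq_of_comp_eq (F.continuous.comp G.continuous) continuous_id
    (by rw [← Function.comp_assoc, hpF, hpG]; rfl) z (by simp [hF, hG])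
  exact ⟨⟨⟨⟨F, G, congrFun hGF, congrFun hFG⟩, F.continuous, G.continuous⟩, congrFun hpF⟩, hF⟩

omit [PathConnectedSpace M] [PathConnectedSpace M'] in
-- As functions of `t` both sides lift the orbit of `p y`, and they agree at `t = 0`.
theorem deck_flow_comm (hp : IsCoveringMap p) {X : Flow ℝ M} {X' : Flow ℝ M'}
    (hX' : ∀ t y, p (X' t y) = X t (p y)) (g : deckGroup p) (t : ℝ) (y : M') :
    g.1 (X' t y) = X' t (g.1 y) := by
  refine congrFun (hp.eq_of_comp_eq (g₁ := fun t : ℝ => g.1 (X' t y))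
    (g₂ := fun t : ℝ => X' t (g.1 y)) (by fun_prop) (by fun_prop) ?_ 0 (by simp)) t
  ext t
  simp only [Function.comp_apply]
  rw [g.2, hX', hX', g.2]

variable (hr : ∀ y : M', (FundamentalGroup.map p y).range = commutator (FundamentalGroup M (p y)))
include hr

omit [PathConnectedSpace M'] in
theorem pathClass_map_loop (x₀ : M) {y : M'} (c : Path y y) :
    pathClass x₀ (c.map p.continuous) = 0 := by
  rw [← freeLoopClass_eq_pathClass]
  refine freeLoopClass_eq_zero_of_mem_commutator x₀ _ ?_
  rw [← hr]
  exact ⟨FundamentalGroup.fromPath (Path.Homotopic.Quotient.mk c), rfl⟩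

omit [PathConnectedSpace M'] in
theorem pathClass_map_eq (x₀ : M) {y z : M'} (c d : Path y z) :
    pathClass x₀ (c.map p.continuous) = pathClass x₀ (d.map p.continuous) := by
  have h := pathClass_map_loop hr x₀ (c.trans d.symm)
  rw [Path.map_trans, pathClass_trans, ← Path.map_symm, pathClass_symm, ← sub_eq_add_neg,
    sub_eq_zero] at h
  exact h

/-- The class of `g` may be computed from any starting point: a path `q` from `y₀` to `y` and its
translate by `g` have the same projection, so their contributions cancel. -/
theorem pathClass_map_eq_deckClass (y₀ : M') (g : deckGroup p) {y : M'} (c : Path y (g.1 y)) :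
    pathClass (p y₀) (c.map p.continuous) = deckClass p y₀ g := by
  have h0 : deckClass p y₀ g = pathClass (p y₀)
      ((PathConnectedSpace.somePath y₀ (g.1 y₀)).map p.continuous) := by
    unfold deckClass
    rw [basedLoopClass_eq_pathClass]
    exact pathClass_congr _ _ _ fun t => rfl
  have q := PathConnectedSpace.somePath y₀ y
  have h1 := pathClass_map_eq hr (p y₀) (q.trans c)
    ((PathConnectedSpace.somePath y₀ (g.1 y₀)).trans (q.map g.1.continuous))
  rw [Path.map_trans, Path.map_trans, pathClass_trans, pathClass_trans, ← h0] at h1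
  have h2 : pathClass (p y₀) ((q.map g.1.continuous).map p.continuous)
      = pathClass (p y₀) (q.map p.continuous) :=
    pathClass_congr _ _ _ fun t => g.2 (q t)
  rw [h2, add_comm] at h1
  exact add_right_cancel h1

theorem deckClass_mul (y₀ : M') (g h : deckGroup p) :
    deckClass p y₀ (g * h) = deckClass p y₀ g + deckClass p y₀ h := by
  have c := PathConnectedSpace.somePath y₀ (h.1 y₀)
  have d : Path (h.1 y₀) (g.1 (h.1 y₀)) := PathConnectedSpace.somePath _ _
  have h1 := pathClass_map_eq_deckClass hr y₀ (g * h) (y := y₀) (c.trans d)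
  have h2 : pathClass (p y₀) ((c.trans d).map p.continuous)
      = deckClass p y₀ g + deckClass p y₀ h := by
    rw [Path.map_trans, pathClass_trans, pathClass_map_eq_deckClass hr y₀ h c,
      pathClass_map_eq_deckClass hr y₀ g d, add_comm]
  exact h1.symm.trans h2

theorem freeLoopClass_orbitLoop {X : Flow ℝ M} {X' : Flow ℝ M'}
    (hX' : ∀ t y, p (X' t y) = X t (p y)) (y₀ : M') (g : deckGroup p) {y : M'} {T : ℝ}
    (hg : X' T y = g.1 y) (hT : X T (p y) = p y) :
    freeLoopClass (p y₀) (orbitLoop X (p y) T hT) = deckClass p y₀ g := by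
  let c : Path y (g.1 y) :=
    { toFun := fun s => X' ((s : ℝ) * T) y
      continuous_toFun := by fun_prop
      source' := by simp
      target' := by simpa using hg }
  rw [freeLoopClass_eq_pathClass, ← pathClass_map_eq_deckClass hr y₀ g c]
  exact pathClass_congr _ _ _ fun s => (hX' _ _).symm

end Cover

/-! ### Regularity of the inverse of a change of time -/

section ImplicitTime

/-- By monotonicity `S` stays within `ε` of its value at `(z, t)` as long as the values of `T` at `S
z t ± ε` lie on either side of the time, which is an open condition. -/
theorem continuous_of_strictMono_apply_eq {Z : Type*} [TopologicalSpace Z] {T : Z → ℝ → ℝ}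
    (hT : Continuous fun q : Z × ℝ => T q.1 q.2) (hm : ∀ z, StrictMono (T z)) {S : Z → ℝ → ℝ}
    (hS : ∀ z t, T z (S z t) = t) : Continuous fun q : Z × ℝ => S q.1 q.2 := by
  refine continuous_iff_continuousAt.2 fun ⟨z, t⟩ => ?_
  refine Metric.tendsto_nhds.2 fun ε hε => ?_
  have h1 : T z (S z t - ε) < t := by
    conv_rhs => rw [← hS z t]
    exact hm z (by linarith)
  have h2 : t < T z (S z t + ε) := by
    conv_lhs => rw [← hS z t]
    exact hm z (by linarith)
  have c1 : Continuous fun q : Z × ℝ => T q.1 (S z t - ε) :=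
    hT.comp (continuous_fst.prodMk continuous_const)
  have c2 : Continuous fun q : Z × ℝ => T q.1 (S z t + ε) :=
    hT.comp (continuous_fst.prodMk continuous_const)
  filter_upwards [(isOpen_lt c1 continuous_snd).mem_nhds h1,
    (isOpen_lt continuous_snd c2).mem_nhds h2] with q hq1 hq2
  change T q.1 (S z t - ε) < q.2 at hq1
  change q.2 < T q.1 (S z t + ε) at hq2
  have e1 : S z t - ε < S q.1 q.2 := (hm q.1).lt_iff_lt.1 (by rwa [hS])
  have e2 : S q.1 q.2 < S z t + ε := (hm q.1).lt_iff_lt.1 (by rwa [hS])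
  rw [Real.dist_eq, abs_lt]
  constructor <;> linarith

variable {E : Type*} [NormedAddCommGroup E] [NormedSpace ℝ E] [CompleteSpace E]
  {M : Type*} [TopologicalSpace M] [ChartedSpace E M] [IsManifold 𝓘(ℝ, E) ∞ M]

/-- The implicit function theorem for `T(s, x) - t`, with `x` read in a chart, provides a smooth
local solution. -/
theorem contMDiff_of_apply_eq {T : ℝ × M → ℝ}
    (hT : ContMDiff (𝓘(ℝ, ℝ).prod 𝓘(ℝ, E)) 𝓘(ℝ, ℝ) ∞ T) {T' : ℝ × M → ℝ}
    (hd : ∀ q : ℝ × M, HasDerivAt (fun s => T (s, q.2)) (T' q) q.1) (hd0 : ∀ q, T' q ≠ 0)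
    {S : ℝ × M → ℝ} (hS : Continuous S) (hTS : ∀ t x, T (S (t, x), x) = t) :
    ContMDiff (𝓘(ℝ, ℝ).prod 𝓘(ℝ, E)) 𝓘(ℝ, ℝ) ∞ S := by
  rintro ⟨t₀, x₀⟩
  set φ := extChartAt 𝓘(ℝ, E) x₀ with hφ
  let F : (ℝ × E) × ℝ → ℝ := fun w => T (w.2, φ.symm w.1.2) - w.1.1
  let u : (ℝ × E) × ℝ := ((t₀, φ x₀), S (t₀, x₀))
  have h1 : ContMDiffAt 𝓘(ℝ, E) 𝓘(ℝ, E) ∞ φ.symm (φ x₀) :=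
    (contMDiffOn_extChartAt_symm (I := 𝓘(ℝ, E)) (n := ∞) x₀).contMDiffAt
      (extChartAt_target_mem_nhds x₀)
  have h2 : ContMDiffAt 𝓘(ℝ, (ℝ × E) × ℝ) 𝓘(ℝ, E) ∞ (fun w : (ℝ × E) × ℝ => φ.symm w.1.2) u :=
    ContMDiffAt.comp (g := φ.symm) (f := fun w : (ℝ × E) × ℝ => w.1.2) u h1
      (contDiff_snd.comp contDiff_fst).contMDiff.contMDiffAt
  have hF : ContDiffAt ℝ ∞ F u := by
    have h3 : ContMDiffAt 𝓘(ℝ, (ℝ × E) × ℝ) 𝓘(ℝ, ℝ) ∞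
        (fun w : (ℝ × E) × ℝ => T (w.2, φ.symm w.1.2)) u :=
      (hT _).comp u (contDiff_snd.contMDiff.contMDiffAt.prodMk h2)
    exact h3.contDiffAt.sub (contDiff_fst.comp contDiff_fst).contDiffAt
  have hx : φ.symm (φ x₀) = x₀ := extChartAt_to_inv x₀
  have hFs : HasDerivAt (fun s => F (u.1, s)) (T' (S (t₀, x₀), x₀)) u.2 := by
    have := (hd (S (t₀, x₀), x₀)).sub_const t₀
    simp only [F, u, hx]
    exact this
  have hinv : (fderiv ℝ F u ∘L .inr ℝ (ℝ × E) ℝ).IsInvertible := by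
    have h4 : HasDerivAt (fun s => F (u.1, s)) (fderiv ℝ F u (0, 1)) u.2 := by
      have h5 : HasDerivAt (fun s : ℝ => ((u.1, s) : (ℝ × E) × ℝ)) (0, 1) u.2 :=
        (hasDerivAt_const _ _).prodMk (hasDerivAt_id _)
      exact (hF.differentiableAt (by simp)).hasFDerivAt.comp_hasDerivAt _ h5
    refine ⟨ContinuousLinearEquiv.unitsEquivAut ℝ (Units.mk0 _ (hd0 (S (t₀, x₀), x₀))), ?_⟩
    ext
    simp [← hFs.unique h4]
  have hψ := hF.contDiffAt_implicitFunction (by simp) hinv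
  have hev := hF.eventually_apply_eq_iff_implicitFunction (by simp) hinv
  have hφc : ContMDiffAt (𝓘(ℝ, ℝ).prod 𝓘(ℝ, E)) 𝓘(ℝ, ℝ × E) ∞
      (fun q : ℝ × M => (q.1, φ q.2)) (t₀, x₀) :=
    contMDiffAt_fst.prodMk_space
      ((contMDiffAt_extChartAt (I := 𝓘(ℝ, E)) (n := ∞)).comp (t₀, x₀) contMDiffAt_snd)
  -- Continuity of `S` keeps its graph where the local solution is unique, so `S` is that solution.
  have hc : ContinuousAt (fun q : ℝ × M => ((q.1, φ q.2), S q)) (t₀, x₀) :=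
    hφc.continuousAt.prodMk hS.continuousAt
  refine (hψ.contMDiffAt.comp (t₀, x₀) hφc).congr_of_eventuallyEq ?_
  filter_upwards [hc.eventually hev, continuousAt_snd.eventually
    (extChartAt_source_mem_nhds (I := 𝓘(ℝ, E)) x₀)] with q hq hs
  refine (hq.1 ?_).symm
  simp only [F, u, hx, hTS]
  rw [φ.left_inv hs, hTS, sub_self, sub_self]

end ImplicitTime

/-! ### Small cocycles and the time-changed flow -/

section Cocycle

variable {E : Type*} [NormedAddCommGroup E] [NormedSpace ℝ E]
  {M : Type*} [TopologicalSpace M] [ChartedSpace E M]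

/-- `A` is the additive cocycle over the flow `X` obtained by integrating the closed 1-form `α`
along the orbits, and `α` is small on the generator of `X`. -/
structure IsSmallCocycle (X : Flow ℝ M) (α : ∀ x : M, TangentSpace 𝓘(ℝ, E) x →L[ℝ] ℝ)
    (A : ℝ → M → ℝ) : Prop where
  zero : ∀ x, A 0 x = 0
  add : ∀ s t x, A (s + t) x = A s x + A t (X s x)
  primitive : ∀ s x, ∃ f₀ f₁ : M → ℝ, ContMDiff 𝓘(ℝ, E) 𝓘(ℝ, ℝ) ∞ f₀ ∧
    ContMDiff 𝓘(ℝ, E) 𝓘(ℝ, ℝ) ∞ f₁ ∧ (∀ᶠ z in 𝓝 x, α z = differential f₀ z) ∧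
    (∀ᶠ z in 𝓝 (X s x), α z = differential f₁ z) ∧
    ∀ᶠ q in 𝓝 (s, x), A q.1 q.2 = f₁ (X q.1 q.2) - f₀ q.2
  small : ∀ x, |formAt α x (flowVelocity E X x)| < 1 / 2

namespace IsSmallCocycle

variable {X : Flow ℝ M} {α : ∀ x : M, TangentSpace 𝓘(ℝ, E) x →L[ℝ] ℝ} {A : ℝ → M → ℝ}
  (h : IsSmallCocycle X α A) (hX : IsSmoothFlow E X)
include h hX

theorem contMDiff : ContMDiff (𝓘(ℝ, ℝ).prod 𝓘(ℝ, E)) 𝓘(ℝ, ℝ) ∞ (fun q : ℝ × M => A q.1 q.2) := by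
  rintro ⟨s, x⟩
  obtain ⟨f₀, f₁, h₀, h₁, -, -, hA⟩ := h.primitive s x
  refine ContMDiffAt.congr_of_eventuallyEq ?_ hA
  exact ((h₁.comp hX.contMDiff).sub (h₀.comp contMDiff_snd)) (s, x)

theorem hasDerivAt (s : ℝ) (x : M) :
    HasDerivAt (fun s => A s x) (formAt α (X s x) (flowVelocity E X (X s x))) s := by
  obtain ⟨f₀, f₁, h₀, h₁, -, hα₁, hA⟩ := h.primitive s x
  have hA' : ∀ᶠ s' in 𝓝 s, A s' x = f₁ (X s' x) - f₀ x :=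
    (Continuous.prodMk_left x).continuousAt.eventually hA
  have e1 := HasMFDerivAt.comp (f := fun s : ℝ => X s x) s
    ((h₁ (X s x)).mdifferentiableAt (by simp)).hasMFDerivAt
    ((hX.contMDiff_time x).mdifferentiable (by simp) s).hasMFDerivAt
  have e2 : HasFDerivAt (fun s : ℝ => f₁ (X s x)) ((formAt (E := E) (differential f₁) (X s x)).comp
      (mfderiv 𝓘(ℝ, ℝ) 𝓘(ℝ, E) (fun s : ℝ => X s x) s : ℝ →L[ℝ] E)) s :=
    hasMFDerivAt_iff_hasFDerivAt.1 e1
  have e3 : formAt α (X s x) = formAt (E := E) (differential f₁) (X s x) := hα₁.self_of_nhds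
  have e4 := (e2.hasDerivAt.sub_const (f₀ x)).congr_of_eventuallyEq hA'
  have e5 := hX.mfderiv_time s 1 x
  rw [one_smul] at e5
  rw [e3, ← e5]
  exact e4

theorem abs_sub_le (s t : ℝ) (x : M) : |A s x - A t x| ≤ 1 / 2 * |s - t| := by
  have h1 := Convex.norm_image_sub_le_of_norm_hasDerivWithin_le (s := Set.univ) (C := 1 / 2)
    (f := fun s => A s x) (x := t) (y := s)
    (fun s _ => (h.hasDerivAt hX s x).hasDerivWithinAt)
    (fun s _ => (h.small (X s x)).le) convex_univ (Set.mem_univ _) (Set.mem_univ _)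
  simpa [Real.norm_eq_abs] using h1

theorem strictMono (x : M) : StrictMono fun s => s + A s x := by
  intro s t hst
  have := abs_le.1 (h.abs_sub_le hX s t x)
  rw [abs_of_neg (by linarith)] at this
  dsimp only
  linarith [this.2]

theorem abs_le (s : ℝ) (x : M) : |A s x| ≤ 1 / 2 * |s| := by
  simpa [h.zero] using h.abs_sub_le hX s 0 x

theorem surjective (x : M) : Function.Surjective fun s => s + A s x := by
  have hc : Continuous fun s => s + A s x :=
    continuous_id.add (continuous_iff_continuousAt.2 fun s => (h.hasDerivAt hX s x).continuousAt)
  intro t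
  -- Since `|A s x| ≤ |s| / 2`, the function `s + A s x` is at least `|t|` at `2|t|` and at most
  -- `-|t|` at `-2|t|`.
  have h1 := _root_.abs_le.1 (h.abs_le hX (2 * |t|) x)
  have h2 := _root_.abs_le.1 (h.abs_le hX (-(2 * |t|)) x)
  rw [abs_neg] at h2
  rw [abs_of_nonneg (a := 2 * |t|) (by positivity)] at h1 h2
  have h3 := neg_abs_le t
  have h4 := le_abs_self t
  exact mem_range_of_exists_le_of_exists_ge hc ⟨-(2 * |t|), by linarith [h2.2]⟩
    ⟨2 * |t|, by linarith [h1.1]⟩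

omit hX in
/-- The time of `X` after which the time `t` has passed for the time-changed flow. -/
def time (hX : IsSmoothFlow E X) (t : ℝ) (x : M) : ℝ := (h.surjective hX x t).choose

theorem time_add (t : ℝ) (x : M) : h.time hX t x + A (h.time hX t x) x = t :=
  (h.surjective hX x t).choose_spec

theorem time_eq {s t : ℝ} {x : M} (hs : s + A s x = t) : h.time hX t x = s :=
  (h.strictMono hX x).injective ((h.time_add hX t x).trans hs.symm)

theorem continuous_time : Continuous fun q : ℝ × M => h.time hX q.1 q.2 := by
  have hT : Continuous fun q : M × ℝ => q.2 + A q.2 q.1 :=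
    continuous_snd.add ((h.contMDiff hX).continuous.comp continuous_swap)
  exact (continuous_of_strictMono_apply_eq hT (h.strictMono hX)
    (S := fun x t => h.time hX t x) (fun x t => h.time_add hX t x)).comp continuous_swap

theorem contMDiff_time [IsManifold 𝓘(ℝ, E) ∞ M] [CompleteSpace E] :
    ContMDiff (𝓘(ℝ, ℝ).prod 𝓘(ℝ, E)) 𝓘(ℝ, ℝ) ∞ (fun q : ℝ × M => h.time hX q.1 q.2) := by
  refine contMDiff_of_apply_eq (T := fun q => q.1 + A q.1 q.2)
    (contMDiff_fst.add (h.contMDiff hX))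
    (fun q => (hasDerivAt_id q.1).add (h.hasDerivAt hX q.1 q.2)) (fun q => ?_)
    (h.continuous_time hX) (fun t x => h.time_add hX t x)
  have := (abs_lt.1 (h.small (X q.1 q.2))).1
  exact ne_of_gt (by linarith)

omit hX in
/-- The time-changed flow. -/
def flow (hX : IsSmoothFlow E X) : Flow ℝ M where
  toFun t x := X (h.time hX t x) x
  cont' := X.cont'.comp ((h.continuous_time hX).prodMk continuous_snd)
  map_zero' x := by
    rw [h.time_eq hX (s := 0) (by simp [h.zero]), X.map_zero_apply]
  map_add' s t x := by
    rw [← X.map_add]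
    congr 1
    -- By the cocycle identity the changed times of consecutive orbit pieces add up.
    refine h.time_eq hX ?_
    have h1 := h.time_add hX t x
    have h2 := h.time_add hX s (X (h.time hX t x) x)
    rw [add_comm (h.time hX s _), h.add]
    linarith

theorem flow_apply (t : ℝ) (x : M) : h.flow hX t x = X (h.time hX t x) x := rfl

theorem isSmoothFlow_flow [IsManifold 𝓘(ℝ, E) ∞ M] [CompleteSpace E] :
    IsSmoothFlow E (h.flow hX) :=
  hX.contMDiff.comp ((h.contMDiff_time hX).prodMk contMDiff_snd)

theorem flow_add (s : ℝ) (x : M) : h.flow hX (s + A s x) x = X s x := by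
  rw [h.flow_apply hX, h.time_eq hX rfl]

theorem isTimeChange : IsTimeChange X (h.flow hX) α A where
  flow_eq := h.flow_add hX
  zero := h.zero
  primitive := h.primitive
  small := h.small
  exists_time t x := by
    -- From `|A s x| ≤ |s| / 2`, the times `s` and `t` have the same sign and `|t| ≤ 3/2 |s|`.
    refine ⟨h.time hX t x, h.time_add hX t x, fun ht => ?_, fun ht => ?_⟩
    all_goals
      have h1 := h.time_add hX t x
      have h2 := _root_.abs_le.1 (h.abs_le hX (h.time hX t x) x)
      rcases abs_cases (h.time hX t x) with ⟨h3, h4⟩ | ⟨h3, h4⟩ <;> rw [h3] at h2 <;>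
        linarith [h2.1, h2.2]

/-- The change of time along an orbit. -/
theorem exists_orderIso (x : M) : ∃ τ : ℝ ≃o ℝ, ∀ s, τ s = s + A s x :=
  ⟨(h.strictMono hX x).orderIsoOfSurjective _ (h.surjective hX x), fun _ => rfl⟩

omit h in
theorem continuous_flow_param {Z : Type*} [TopologicalSpace Z]
    {α : Z → ∀ x : M, TangentSpace 𝓘(ℝ, E) x →L[ℝ] ℝ} {A : Z → ℝ → M → ℝ}
    (h : ∀ z, IsSmallCocycle X (α z) (A z)) (hA : Continuous fun q : Z × ℝ × M => A q.1 q.2.1 q.2.2) :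
    Continuous fun q : Z × ℝ × M => (h q.1).flow hX q.2.1 q.2.2 := by
  have hT : Continuous fun q : (Z × M) × ℝ => q.2 + A q.1.1 q.2 q.1.2 :=
    continuous_snd.add (hA.comp ((continuous_fst.comp continuous_fst).prodMk
      (continuous_snd.prodMk (continuous_snd.comp continuous_fst))))
  have hc := continuous_of_strictMono_apply_eq (T := fun (z : Z × M) s => s + A z.1 s z.2) hT
    (fun z => (h z.1).strictMono hX z.2) (S := fun z t => (h z.1).time hX t z.2)
    (fun z t => (h z.1).time_add hX t z.2)
  exact X.cont'.comp ((hc.comp ((continuous_fst.prodMk (continuous_snd.comp continuous_snd)).prodMk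
    (continuous_fst.comp continuous_snd))).prodMk (continuous_snd.comp continuous_snd))

end IsSmallCocycle

end Cocycle

/-! ### Equivariant functions on the cover and closed forms in a given class -/

section Evaluation

variable {M : Type*} [TopologicalSpace M] {x₀ : M}

theorem FirstCohomology.map_add (μ : FirstCohomology x₀) (a b : FirstHomology x₀) :
    μ (a + b) = μ a + μ b := AddMonoidHom.map_add (show FirstHomology x₀ →+ ℝ from μ) a b

theorem FirstCohomology.zero_apply (a : FirstHomology x₀) : (0 : FirstCohomology x₀) a = 0 := rfl

theorem FirstCohomology.continuous_eval (a : FirstHomology x₀) :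
    Continuous fun μ : FirstCohomology x₀ => μ a :=
  (continuous_apply a).comp continuous_induced_dom

end Evaluation

section EquivariantPartition

variable {E : Type*} [NormedAddCommGroup E] [NormedSpace ℝ E]
  {M M' : Type*} [TopologicalSpace M] [TopologicalSpace M'] [ChartedSpace E M]
  [PathConnectedSpace M']

variable (E) in
/-- A smooth partition of unity `ρ` on `M` together with locally constant functions `c i` on the
preimages in the cover of the supports of the `ρ i`, that are equivariant under deck
transformations. -/
structure IsEquivariantPartition (p : C(M', M)) (y₀ : M') {ι : Type*} [Fintype ι] (ρ : ι → M → ℝ)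
    (c : ι → M' → FirstHomology (p y₀)) : Prop where
  smooth : ∀ i, ContMDiff 𝓘(ℝ, E) 𝓘(ℝ, ℝ) ∞ (ρ i)
  sum_eq_one : ∀ x, ∑ i, ρ i x = 1
  locally_const : ∀ i z, (∀ᶠ w in 𝓝 z, c i w = c i z) ∨ ∀ᶠ x in 𝓝 (p z), ρ i x = 0
  deck : ∀ i z (g : deckGroup p), c i (g.1 z) = c i z + deckClass p y₀ g ∨
    ∀ᶠ x in 𝓝 (p z), ρ i x = 0

/-- Over a small open set `V i` the cover has a section `s i`; a point `z` over `V i` is the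
translate of `s i (p z)` by a unique deck transformation, and `c i z` is its class. -/
theorem exists_isEquivariantPartition [FiniteDimensional ℝ E] [T2Space M] [CompactSpace M]
    [PathConnectedSpace M] [IsManifold 𝓘(ℝ, E) ∞ M] [LocallyPathConnectedSpace M']
    {p : C(M', M)} (hp : IsCoveringMap p)
    (hr : ∀ y : M', (FundamentalGroup.map p y).range = commutator (FundamentalGroup M (p y)))
    (y₀ : M') : ∃ (t : Finset M) (ρ : t → M → ℝ) (c : t → M' → FirstHomology (p y₀)),
      IsEquivariantPartition E p y₀ ρ c := by
  classical
  have hs := IsCoveringMap.surjective_of_pathConnected hp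
  choose lift hlift using hs
  choose e he hpe using hp.isLocalHomeomorph
  let V : M → Set M := fun x => (e (lift x)).target
  have hxV : ∀ x, x ∈ V x := fun x => by
    have := (e (lift x)).map_source (he (lift x))
    rwa [← hpe, hlift] at this
  obtain ⟨t, ht⟩ := CompactSpace.elim_nhds_subcover V
    fun x => (e (lift x)).open_target.mem_nhds (hxV x)
  obtain ⟨ρ, hρ⟩ := SmoothPartitionOfUnity.exists_isSubordinate 𝓘(ℝ, E) (isClosed_univ (X := M))
    (fun i : t => V i) (fun i => (e (lift i)).open_target) (by
      rw [← Set.top_eq_univ, ← ht]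
      exact fun x hx => by simpa using hx)
  let s : t → M → M' := fun i => (e (lift i)).symm
  have hps : ∀ i : t, ∀ x ∈ V i, p (s i x) = x := fun i x hx => by
    have := (e (lift i)).right_inv hx
    rwa [← hpe] at this
  have hg : ∀ (i : t) (z : M'), ∃ g : deckGroup p, p z ∈ V i → g.1 (s i (p z)) = z := fun i z => by
    by_cases hz : p z ∈ V i
    · obtain ⟨g, hg⟩ := exists_deck hp hr (hps i _ hz)
      exact ⟨g, fun _ => hg⟩
    -- The value chosen here is arbitrary: `ρ i` vanishes near points outside `V i`.
    · exact ⟨1, fun h => absurd h hz⟩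
  choose g hg using hg
  have hzero : ∀ i : t, ∀ x ∉ V i, ∀ᶠ x in 𝓝 x, ρ i x = 0 := fun i x hx =>
    notMem_tsupport_iff_eventuallyEq.1 fun h => hx (hρ i h)
  refine ⟨t, fun i => ρ i, fun i z => deckClass p y₀ (g i z), fun i => (ρ i).contMDiff,
    fun x => ?_, fun i z => ?_, fun i z γ => ?_⟩
  · have := ρ.sum_eq_one (Set.mem_univ x)
    rwa [finsum_eq_sum_of_fintype] at this
  · by_cases hz : p z ∈ V i
    · left
      have hV : ∀ᶠ w in 𝓝 z, p w ∈ V i :=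
        p.continuous.continuousAt.eventually ((e (lift i)).open_target.mem_nhds hz)
      have hsrc : ∀ᶠ w in 𝓝 z, w ∈ (e z).source := (e z).open_source.mem_nhds (he z)
      have hc : ContinuousAt (fun w => (g i z).1 (s i (p w))) z :=
        (g i z).1.continuous.continuousAt.comp
          (((e (lift i)).continuousAt_symm hz).comp p.continuous.continuousAt)
      have hsrc' : ∀ᶠ w in 𝓝 z, (g i z).1 (s i (p w)) ∈ (e z).source := by
        refine hc.eventually ?_
        dsimp only
        rwa [hg i z hz]
      filter_upwards [hV, hsrc, hsrc'] with w h1 h2 h3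
      -- Both points lie in the sheet around `z` and have the same projection; hence the deck
      -- transformation of `w` is that of `z`.
      have h4 : (g i z).1 (s i (p w)) = w := by
        refine (e z).injOn h3 h2 ?_
        rw [← hpe, (g i z).2, hps i _ h1]
      rw [deckGroup_ext hp (h4.trans (hg i w h1).symm)]
    · exact Or.inr (hzero i _ hz)
  · by_cases hz : p z ∈ V i
    · left
      have h1 := hg i (γ.1 z) (by rwa [γ.2])
      have h2 : g i (γ.1 z) = γ * g i z := by
        refine deckGroup_ext hp (h1.trans ?_)
        rw [γ.2]
        exact (congrArg γ.1 (hg i z hz)).symm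
      rw [h2, deckClass_mul hr, add_comm]
    · exact Or.inr (hzero i _ hz)

namespace IsEquivariantPartition

/-- The equivariant function on the cover defined by a cohomology class. -/
def equivariantFun {p : C(M', M)} {y₀ : M'} {ι : Type*} [Fintype ι] (ρ : ι → M → ℝ)
    (c : ι → M' → FirstHomology (p y₀)) (μ : FirstCohomology (p y₀)) (z : M') : ℝ :=
  ∑ i, μ (c i z) * ρ i (p z)

/-- A function on `M` whose lift is the equivariant function near `z`. -/
def localFun {p : C(M', M)} {y₀ : M'} {ι : Type*} [Fintype ι] (ρ : ι → M → ℝ)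
    (c : ι → M' → FirstHomology (p y₀)) (μ : FirstCohomology (p y₀)) (z : M') (x : M) : ℝ :=
  ∑ i, μ (c i z) * ρ i x

variable {p : C(M', M)} {y₀ : M'} {ι : Type*} [Fintype ι] {ρ : ι → M → ℝ}
    {c : ι → M' → FirstHomology (p y₀)} (h : IsEquivariantPartition E p y₀ ρ c)
include h

theorem contMDiff_localFun (μ : FirstCohomology (p y₀)) (z : M') :
    ContMDiff 𝓘(ℝ, E) 𝓘(ℝ, ℝ) ∞ (localFun ρ c μ z) :=
  contMDiff_finsetSum fun i _ => contMDiff_const.mul (h.smooth i)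

/-- The neighbourhoods do not depend on `μ`, which later gives joint continuity in `μ` and the
point. -/
theorem eventually_localFun_eq (z : M') : ∀ᶠ w in 𝓝 z, ∀ᶠ x in 𝓝 (p w),
    ∀ μ, localFun ρ c μ w x = localFun ρ c μ z x := by
  have h1 : ∀ i, ∀ᶠ w in 𝓝 z, ∀ᶠ x in 𝓝 (p w), ∀ μ : FirstCohomology (p y₀),
      μ (c i w) * ρ i x = μ (c i z) * ρ i x := fun i => by
    rcases h.locally_const i z with h2 | h2
    · filter_upwards [h2] with w hw
      rw [hw]
      exact Filter.Eventually.of_forall fun _ _ => rfl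
    · filter_upwards [p.continuous.continuousAt.eventually h2.eventually_nhds] with w hw
      filter_upwards [hw] with x hx
      simp [hx]
  filter_upwards [Filter.eventually_all.2 h1] with w hw
  filter_upwards [Filter.eventually_all.2 hw] with x hx μ
  exact Finset.sum_congr rfl fun i _ => hx i μ

theorem eventually_equivariantFun_eq (z : M') : ∀ᶠ w in 𝓝 z,
    ∀ μ, equivariantFun ρ c μ w = localFun ρ c μ z (p w) := by
  filter_upwards [h.eventually_localFun_eq z] with w hw
  exact hw.self_of_nhds

/-- Every coefficient that matters near `p z` changes by the same `μ(g)`, and the `ρ i` add up to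
`1`. -/
theorem eventually_localFun_deck (z : M') (g : deckGroup p) : ∀ᶠ x in 𝓝 (p z),
    ∀ μ, localFun ρ c μ (g.1 z) x = localFun ρ c μ z x + μ (deckClass p y₀ g) := by
  have h1 : ∀ i, ∀ᶠ x in 𝓝 (p z), ∀ μ : FirstCohomology (p y₀),
      μ (c i (g.1 z)) * ρ i x = μ (c i z) * ρ i x + μ (deckClass p y₀ g) * ρ i x := fun i => by
    rcases h.deck i z g with h2 | h2
    · refine Filter.Eventually.of_forall fun x μ => ?_
      rw [h2, FirstCohomology.map_add, add_mul]
    · filter_upwards [h2] with x hx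
      simp [hx]
  filter_upwards [Filter.eventually_all.2 h1] with x hx μ
  unfold localFun
  rw [Finset.sum_congr rfl fun i _ => hx i μ, Finset.sum_add_distrib, ← Finset.mul_sum,
    h.sum_eq_one, mul_one]

theorem equivariantFun_deck (μ : FirstCohomology (p y₀)) (z : M') (g : deckGroup p) :
    equivariantFun ρ c μ (g.1 z) = equivariantFun ρ c μ z + μ (deckClass p y₀ g) := by
  have := (h.eventually_localFun_deck z g).self_of_nhds μ
  refine Eq.trans ?_ this
  unfold equivariantFun localFun
  rw [g.2]

theorem contMDiff_equivariantFun [ChartedSpace E M'] (hp : ContMDiff 𝓘(ℝ, E) 𝓘(ℝ, E) ∞ p)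
    (μ : FirstCohomology (p y₀)) : ContMDiff 𝓘(ℝ, E) 𝓘(ℝ, ℝ) ∞ (equivariantFun ρ c μ) := by
  intro z
  refine ((h.contMDiff_localFun μ z).comp hp z).congr_of_eventuallyEq ?_
  filter_upwards [h.eventually_equivariantFun_eq z] with w hw
  exact hw μ

end IsEquivariantPartition

end EquivariantPartition

section Differential

variable {E : Type*} [NormedAddCommGroup E] [NormedSpace ℝ E]
  {M : Type*} [TopologicalSpace M] [ChartedSpace E M]

theorem differential_congr_add_const {f g : M → ℝ} {x : M} {a : ℝ}
    (hg : MDifferentiableAt 𝓘(ℝ, E) 𝓘(ℝ, ℝ) g x) (hf : ∀ᶠ z in 𝓝 x, f z = g z + a) :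
    (differential f x : TangentSpace 𝓘(ℝ, E) x →L[ℝ] ℝ) = differential g x := by
  have h := (hg.hasMFDerivAt.add (hasMFDerivAt_const a x)).congr_of_eventuallyEq hf
  exact h.mfderiv.trans (add_zero _)

theorem hasMFDerivAt_sum_const_mul {ι : Type*} (t : Finset ι) (a : ι → ℝ) {f : ι → M → ℝ} {x : M}
    (hf : ∀ i, MDifferentiableAt 𝓘(ℝ, E) 𝓘(ℝ, ℝ) (f i) x) :
    HasMFDerivAt 𝓘(ℝ, E) 𝓘(ℝ, ℝ) (fun z => ∑ i ∈ t, a i * f i z) x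
      (∑ i ∈ t, a i • formAt (E := E) (differential (f i)) x) := by
  classical
  induction t using Finset.induction_on with
  | empty =>
    exact hasMFDerivAt_const 0 x
  | insert i s hi ih =>
    have e1 := Finset.sum_insert (f := fun i => a i • formAt (E := E) (differential (f i)) x) hi
    have e2 : (fun z => ∑ i ∈ insert i s, a i * f i z)
        = a i • f i + fun z => ∑ i ∈ s, a i * f i z := funext fun z => Finset.sum_insert hi
    rw [e2]
    exact (((hf i).hasMFDerivAt.const_smul (a i)).add ih).congr_mfderiv e1.symm

end Differential

section DeformationCocycle

variable {E : Type*} [NormedAddCommGroup E] [NormedSpace ℝ E]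
  {M M' : Type*} [TopologicalSpace M] [TopologicalSpace M'] [ChartedSpace E M]
  [PathConnectedSpace M'] {p : C(M', M)} {y₀ : M'} {ι : Type*} [Fintype ι] {ρ : ι → M → ℝ}
  {c : ι → M' → FirstHomology (p y₀)}

namespace IsEquivariantPartition

variable (ρ c) in
/-- The closed 1-form on `M` whose lift is the differential of the equivariant function. -/
def closedForm (hs : Function.Surjective p) (μ : FirstCohomology (p y₀)) (x : M) :
    TangentSpace 𝓘(ℝ, E) x →L[ℝ] ℝ :=
  differential (localFun ρ c μ (Function.surjInv hs x)) x

variable (ρ c) in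
/-- The cocycle over the flow of `M` obtained by integrating the closed 1-form. -/
def cocycle (hs : Function.Surjective p) (X' : Flow ℝ M') (μ : FirstCohomology (p y₀)) (s : ℝ)
    (x : M) : ℝ :=
  equivariantFun ρ c μ (X' s (Function.surjInv hs x))
    - equivariantFun ρ c μ (Function.surjInv hs x)

variable (h : IsEquivariantPartition E p y₀ ρ c) (hs : Function.Surjective p)
  (hd : ∀ y z : M', p y = p z → ∃ g : deckGroup p, g.1 y = z) (hl : IsLocalHomeomorph p)
  {X : Flow ℝ M} {X' : Flow ℝ M'} (hX' : ∀ t y, p (X' t y) = X t (p y))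
  (hcomm : ∀ (g : deckGroup p) t y, g.1 (X' t y) = X' t (g.1 y))
include h hd

/-- Independence of the chosen lift: local functions at two points of a fibre differ by a constant
near the projection. -/
theorem closedForm_eq (μ : FirstCohomology (p y₀)) (z : M') :
    (closedForm ρ c hs μ (p z) : TangentSpace 𝓘(ℝ, E) (p z) →L[ℝ] ℝ)
      = differential (localFun ρ c μ z) (p z) := by
  obtain ⟨g, hg⟩ := hd z (Function.surjInv hs (p z)) (Function.surjInv_eq hs (p z)).symm
  unfold closedForm
  rw [← hg]
  refine differential_congr_add_const (a := μ (deckClass p y₀ g))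
    ((h.contMDiff_localFun μ z).mdifferentiable (by simp) _) ?_
  filter_upwards [h.eventually_localFun_deck z g] with x hx
  exact hx μ

include hl in
theorem eventually_closedForm_eq (z : M') : ∀ᶠ x in 𝓝 (p z), ∀ μ,
    (closedForm ρ c hs μ x : TangentSpace 𝓘(ℝ, E) x →L[ℝ] ℝ)
      = differential (localFun ρ c μ z) x := by
  rw [← hl.map_nhds_eq z]
  refine Filter.eventually_map.2 ?_
  filter_upwards [h.eventually_localFun_eq z] with w hw μ
  refine (h.closedForm_eq hs hd μ w).trans ?_
  refine differential_congr_add_const (a := 0)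
    ((h.contMDiff_localFun μ z).mdifferentiable (by simp) _) ?_
  filter_upwards [hw] with x hx
  rw [hx, add_zero]

include hcomm in
-- Replacing the chosen lift by another one adds the same constant `μ(g)` at both ends of the orbit
-- piece.
theorem cocycle_eq (μ : FirstCohomology (p y₀)) (s : ℝ) (z : M') :
    cocycle ρ c hs X' μ s (p z) = equivariantFun ρ c μ (X' s z) - equivariantFun ρ c μ z := by
  obtain ⟨g, hg⟩ := hd z (Function.surjInv hs (p z)) (Function.surjInv_eq hs (p z)).symm
  unfold cocycle
  rw [← hg, ← hcomm, h.equivariantFun_deck, h.equivariantFun_deck]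
  ring

include hl hX' hcomm in
theorem eventually_cocycle_eq (s : ℝ) (z : M') : ∀ᶠ q in 𝓝 (s, p z), ∀ μ,
    cocycle ρ c hs X' μ q.1 q.2
      = localFun ρ c μ (X' s z) (X q.1 q.2) - localFun ρ c μ z q.2 := by
  -- The projection is a local homeomorphism, so a statement near `(s, p z)` may be checked near
  -- `(s, z)` in the cover.
  have h0 : 𝓝 (s, p z) = Filter.map (Prod.map id p) (𝓝 (s, z)) := by
    rw [nhds_prod_eq, nhds_prod_eq, ← hl.map_nhds_eq z, ← Filter.prod_map_map_eq', Filter.map_id]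
  rw [h0]
  refine Filter.eventually_map.2 ?_
  have hc : ContinuousAt (fun q : ℝ × M' => X' q.1 q.2) (s, z) := X'.cont'.continuousAt
  filter_upwards [hc.eventually (h.eventually_equivariantFun_eq (X' s z)),
    continuousAt_snd.eventually (h.eventually_equivariantFun_eq z)] with q h1 h2 μ
  simp only [Prod.map_fst, Prod.map_snd, id_eq]
  rw [h.cocycle_eq hs hd hcomm, h1, h2, hX']

include hl hX' hcomm in
theorem continuous_cocycle : Continuous fun q : FirstCohomology (p y₀) × ℝ × M =>
    cocycle ρ c hs X' q.1 q.2.1 q.2.2 := by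
  refine continuous_iff_continuousAt.2 fun ⟨μ, s, x⟩ => ?_
  obtain ⟨z, rfl⟩ := hs x
  have h1 : ∀ z', Continuous fun q : FirstCohomology (p y₀) × M => localFun ρ c q.1 z' q.2 :=
    fun z' => continuous_finsetSum _ fun i _ =>
      ((FirstCohomology.continuous_eval _).comp continuous_fst).mul
        ((h.smooth i).continuous.comp continuous_snd)
  have h2 : Continuous fun q : FirstCohomology (p y₀) × ℝ × M =>
      localFun ρ c q.1 (X' s z) (X q.2.1 q.2.2) - localFun ρ c q.1 z q.2.2 :=
    ((h1 _).comp (continuous_fst.prodMk (X.cont'.comp continuous_snd))).sub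
      ((h1 _).comp (continuous_fst.prodMk (continuous_snd.comp continuous_snd)))
  refine h2.continuousAt.congr ?_
  filter_upwards [continuousAt_snd.eventually
    (h.eventually_cocycle_eq hs hd hl hX' hcomm s z)] with q hq
  exact (hq q.1).symm

include hl hX' hcomm in
theorem isSmallCocycle {μ : FirstCohomology (p y₀)}
    (hμ : ∀ x, |formAt (closedForm (E := E) ρ c hs μ) x (flowVelocity E X x)| < 1 / 2) :
    IsSmallCocycle X (closedForm (E := E) ρ c hs μ) (cocycle ρ c hs X' μ) where
  zero x := by simp [cocycle]
  add s t x := by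
    obtain ⟨z, rfl⟩ := hs x
    rw [← hX']
    simp only [h.cocycle_eq hs hd hcomm]
    rw [← X'.map_add, add_comm t s]
    ring
  primitive s x := by
    obtain ⟨z, rfl⟩ := hs x
    refine ⟨localFun ρ c μ z, localFun ρ c μ (X' s z), h.contMDiff_localFun μ z,
      h.contMDiff_localFun μ _, ?_, ?_, ?_⟩
    · filter_upwards [h.eventually_closedForm_eq hs hd hl z] with x hx
      exact hx μ
    · rw [← hX']
      filter_upwards [h.eventually_closedForm_eq hs hd hl (X' s z)] with x hx
      exact hx μ
    · filter_upwards [h.eventually_cocycle_eq hs hd hl hX' hcomm s z] with q hq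
      exact hq μ
  small := hμ

include hl in
theorem continuous_closedForm_flowVelocity [IsManifold 𝓘(ℝ, E) ∞ M] (hX : IsSmoothFlow E X) :
    Continuous fun q : FirstCohomology (p y₀) × M =>
      formAt (closedForm (E := E) ρ c hs q.1) q.2 (flowVelocity E X q.2) := by
  refine continuous_iff_continuousAt.2 fun ⟨μ, x⟩ => ?_
  obtain ⟨z, rfl⟩ := hs x
  have h1 : ∀ i, Continuous fun x => formAt (E := E) (differential (ρ i)) x (flowVelocity E X x) :=
    fun i => ((isSmoothOneForm_differential (h.smooth i)).contMDiff_apply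
      hX.contMDiff_flowGenerator).continuous
  have h2 : Continuous fun q : FirstCohomology (p y₀) × M =>
      ∑ i, q.1 (c i z) * formAt (E := E) (differential (ρ i)) q.2 (flowVelocity E X q.2) :=
    continuous_finsetSum _ fun i _ => ((FirstCohomology.continuous_eval _).comp continuous_fst).mul
      ((h1 i).comp continuous_snd)
  refine h2.continuousAt.congr ?_
  filter_upwards [continuousAt_snd.eventually
    (h.eventually_closedForm_eq hs hd hl z)] with q hq
  have h3 : HasMFDerivAt 𝓘(ℝ, E) 𝓘(ℝ, ℝ) (localFun ρ c q.1 z) q.2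
      (∑ i, q.1 (c i z) • formAt (E := E) (differential (ρ i)) q.2) :=
    hasMFDerivAt_sum_const_mul _ _ fun i => (h.smooth i).mdifferentiable (by simp) _
  have h4 : formAt (closedForm (E := E) ρ c hs q.1) q.2
      = ∑ i, q.1 (c i z) • formAt (E := E) (differential (ρ i)) q.2 := (hq q.1).trans h3.mfderiv
  rw [h4]
  simp

end IsEquivariantPartition

end DeformationCocycle

/-! ### The shear of the cover and the orbit space of the deformed deck group -/

section Lifting

theorem IsLocalDiffeomorph.contMDiff_of_comp {E F G : Type*} [NormedAddCommGroup E]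
    [NormedSpace ℝ E] [NormedAddCommGroup F] [NormedSpace ℝ F] [TopologicalSpace G]
    {J : ModelWithCorners ℝ F G} {M M' N : Type*} [TopologicalSpace M] [TopologicalSpace M']
    [TopologicalSpace N] [ChartedSpace E M] [ChartedSpace E M'] [ChartedSpace G N] {p : M' → M}
    (hp : IsLocalDiffeomorph 𝓘(ℝ, E) 𝓘(ℝ, E) ∞ p) {φ : N → M'} (hφ : Continuous φ)
    (h : ContMDiff J 𝓘(ℝ, E) ∞ fun x => p (φ x)) : ContMDiff J 𝓘(ℝ, E) ∞ φ := by
  intro x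
  refine ((hp (φ x)).localInverse_contMDiffAt.comp x (h x)).congr_of_eventuallyEq ?_
  filter_upwards [hφ.continuousAt.eventually (hp (φ x)).localInverse_eventuallyEq_left] with y hy
  exact hy.symm

theorem IsSmoothFlow.lift {E : Type*} [NormedAddCommGroup E] [NormedSpace ℝ E] {M M' : Type*}
    [TopologicalSpace M] [TopologicalSpace M'] [ChartedSpace E M] [ChartedSpace E M'] {p : M' → M}
    (hp : IsLocalDiffeomorph 𝓘(ℝ, E) 𝓘(ℝ, E) ∞ p) {X : Flow ℝ M} {X' : Flow ℝ M'}
    (hX' : ∀ t y, p (X' t y) = X t (p y)) (hX : IsSmoothFlow E X) : IsSmoothFlow E X' := by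
  refine hp.contMDiff_of_comp X'.cont' ?_
  simp only [hX']
  exact hX.contMDiff.comp (contMDiff_fst.prodMk (hp.contMDiff.comp contMDiff_snd))

end Lifting

section Shear

variable {E : Type*} [NormedAddCommGroup E] [NormedSpace ℝ E]
  {M M' : Type*} [TopologicalSpace M] [ChartedSpace E M] [TopologicalSpace M']

/-- The map that moves every point along its orbit by the time `f`. -/
def shear (X' : Flow ℝ M') (f : M' → ℝ) (z : M') : M' := X' (f z) z

namespace IsSmallCocycle

variable {X : Flow ℝ M} {α : ∀ x : M, TangentSpace 𝓘(ℝ, E) x →L[ℝ] ℝ} {A : ℝ → M → ℝ}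
  (h : IsSmallCocycle X α A) (hX : IsSmoothFlow E X) {p : C(M', M)} {X' : Flow ℝ M'} {f : M' → ℝ}

variable (p X' f) in
/-- The inverse of `shear X' f`. -/
def unshear (y : M') : M' := X' (h.time hX (-f y) (p y)) y

variable (hX' : ∀ t y, p (X' t y) = X t (p y)) (hA : ∀ s z, A s (p z) = f (X' s z) - f z)

include hA in
-- The preimage of `y` is sought as `X'^s(y)`, which is sheared to `X'^{s + f(X'^s y)}(y)`. The
-- condition `s + f(X'^s y) = 0` reads `s + A s (p y) = -f y`, and `time` solves it.
theorem shear_unshear (y : M') : shear X' f (h.unshear hX p X' f y) = y := by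
  have h1 := h.time_add hX (-f y) (p y)
  unfold shear unshear
  rw [← X'.map_add]
  have h2 : f (X' (h.time hX (-f y) (p y)) y) + h.time hX (-f y) (p y) = 0 := by
    rw [hA] at h1
    linarith
  rw [h2, X'.map_zero_apply]

include hA in
theorem unshear_shear (z : M') : h.unshear hX p X' f (shear X' f z) = z := by
  unfold shear unshear
  have h2 : h.time hX (-f (X' (f z) z)) (p (X' (f z) z)) = -f z := by
    refine h.time_eq hX ?_
    rw [hA, ← X'.map_add, neg_add_cancel, X'.map_zero_apply]
    ring
  rw [h2, ← X'.map_add, neg_add_cancel, X'.map_zero_apply]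

omit [ChartedSpace E M] in
theorem shear_flow (hA : ∀ s z, A s (p z) = f (X' s z) - f z) (s : ℝ) (z : M') :
    shear X' f (X' s z) = X' (s + A s (p z)) (shear X' f z) := by
  unfold shear
  rw [← X'.map_add, ← X'.map_add, hA]
  congr 1
  ring

include hX' hA in
-- The lifted flow, seen from `M` through the inverse of the shear, is the time change. Hence it
-- descends to `M_μ`.
theorem unshear_flow (t : ℝ) (y : M') :
    p (h.unshear hX p X' f (X' t y)) = h.flow hX t (p (h.unshear hX p X' f y)) := by
  set z := h.unshear hX p X' f y with hz
  have h1 : shear X' f z = y := h.shear_unshear hX hA y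
  have h2 := shear_flow hA (h.time hX t (p z)) z
  rw [h.time_add hX, h1] at h2
  rw [← h2, h.unshear_shear hX hA, hX', h.flow_apply]

variable [IsManifold 𝓘(ℝ, E) ∞ M] [CompleteSpace E] [ChartedSpace E M']

/-- The diffeomorphism `shear X' f`. -/
def shearDiffeomorph (hp : IsLocalDiffeomorph 𝓘(ℝ, E) 𝓘(ℝ, E) ∞ p)
    (hX' : ∀ t y, p (X' t y) = X t (p y)) (hA : ∀ s z, A s (p z) = f (X' s z) - f z)
    (hf : ContMDiff 𝓘(ℝ, E) 𝓘(ℝ, ℝ) ∞ f) : M' ≃ₘ^∞⟮𝓘(ℝ, E), 𝓘(ℝ, E)⟯ M' where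
  toFun := shear X' f
  invFun := h.unshear hX p X' f
  left_inv := h.unshear_shear hX hA
  right_inv := h.shear_unshear hX hA
  contMDiff_toFun := (hX.lift hp hX').contMDiff.comp (hf.prodMk contMDiff_id)
  contMDiff_invFun := (hX.lift hp hX').contMDiff.comp
    (((h.contMDiff_time hX).comp (hf.neg.prodMk hp.contMDiff)).prodMk contMDiff_id)

end IsSmallCocycle

end Shear

section DeformedHomeomorph

variable {E : Type*} [NormedAddCommGroup E] [NormedSpace ℝ E] [CompleteSpace E]
  {M M' : Type*} [TopologicalSpace M] [ChartedSpace E M] [IsManifold 𝓘(ℝ, E) ∞ M]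
  [TopologicalSpace M'] [ChartedSpace E M'] [PathConnectedSpace M']

namespace IsSmallCocycle

variable {X : Flow ℝ M} {α : ∀ x : M, TangentSpace 𝓘(ℝ, E) x →L[ℝ] ℝ} {A : ℝ → M → ℝ}
  (h : IsSmallCocycle X α A) (hX : IsSmoothFlow E X) {p : C(M', M)} {X' : Flow ℝ M'} {f : M' → ℝ}
  (hp : IsLocalDiffeomorph 𝓘(ℝ, E) 𝓘(ℝ, E) ∞ p) (hs : Function.Surjective p)
  (hd : ∀ y z : M', p y = p z → ∃ g : deckGroup p, g.1 y = z)
  (hX' : ∀ t y, p (X' t y) = X t (p y))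
  (hcomm : ∀ (g : deckGroup p) t y, g.1 (X' t y) = X' t (g.1 y))
  (hA : ∀ s z, A s (p z) = f (X' s z) - f z) (hf : ContMDiff 𝓘(ℝ, E) 𝓘(ℝ, ℝ) ∞ f)
  {y₀ : M'} {μ : FirstCohomology (p y₀)}
  (hfμ : ∀ z (g : deckGroup p), f (g.1 z) = f z + μ (deckClass p y₀ g))

omit [ChartedSpace E M'] in
include hcomm hfμ in
-- The increment `μ(g)` of `f` is exactly the extra flow time in the deformed action, so the shear
-- conjugates the two actions.
theorem shear_deck (g : deckGroup p) (z : M') :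
    shear X' f (g.1 z) = deformedDeck p X' y₀ μ g (shear X' f z) := by
  unfold shear deformedDeck
  rw [hfμ, ← X'.map_add, hcomm, add_comm]

/-- The orbit space of the deformed deck group is homeomorphic to `M`. -/
def deformedHomeomorph : DeformedSpace p X' y₀ μ ≃ₜ M := by
  have hq : Continuous fun y => p (h.unshear hX p X' f y) :=
    p.continuous.comp (h.shearDiffeomorph hX hp hX' hA hf).symm.continuous
  have ho : IsOpenMap fun y => p (h.unshear hX p X' f y) :=
    hp.isOpenMap.comp (h.shearDiffeomorph hX hp hX' hA hf).symm.toHomeomorph.isOpenMap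
  -- Undoing the shear turns deformed orbits into fibres of `p`; this gives both well-definedness
  -- and injectivity.
  let e : DeformedSpace p X' y₀ μ → M := Quot.lift (fun y => p (h.unshear hX p X' f y)) (by
    rintro y _ ⟨g, rfl⟩
    rw [← h.shear_unshear hX hA y, ← shear_deck hcomm hfμ, h.unshear_shear hX hA,
      h.unshear_shear hX hA, g.2])
  have hinj : Function.Injective e := by
    rintro ⟨y⟩ ⟨y'⟩ hyy'
    obtain ⟨g, hg⟩ := hd _ _ (show p (h.unshear hX p X' f y) = p (h.unshear hX p X' f y') from hyy')
    refine Quot.sound ⟨g, ?_⟩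
    rw [← h.shear_unshear hX hA y', ← hg, shear_deck hcomm hfμ, h.shear_unshear hX hA]
  have hsurj : Function.Surjective e := fun x => by
    obtain ⟨z, rfl⟩ := hs x
    exact ⟨deformedProj p X' y₀ μ (shear X' f z),
      congrArg p (h.unshear_shear hX hA z)⟩
  refine (Equiv.ofBijective e ⟨hinj, hsurj⟩).toHomeomorphOfContinuousOpen
    (continuous_quot_lift _ hq) ?_
  intro V hV
  have h1 : e '' V = (fun y => p (h.unshear hX p X' f y)) '' (deformedProj p X' y₀ μ ⁻¹' V) := by
    ext x
    constructor
    · rintro ⟨⟨y⟩, hy, rfl⟩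
      exact ⟨y, hy, rfl⟩
    · rintro ⟨y, hy, rfl⟩
      exact ⟨deformedProj p X' y₀ μ y, hy, rfl⟩
  have h2 : IsOpen (deformedProj p X' y₀ μ ⁻¹' V) := hV.preimage continuous_quot_mk
  exact h1 ▸ ho _ h2

theorem deformedHomeomorph_proj (y : M') :
    h.deformedHomeomorph hX hp hs hd hX' hcomm hA hf hfμ (deformedProj p X' y₀ μ y)
      = p (h.unshear hX p X' f y) := rfl

theorem deformedProj_eq : deformedProj p X' y₀ μ
    = (h.deformedHomeomorph hX hp hs hd hX' hcomm hA hf hfμ).symm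
      ∘ (p ∘ (h.shearDiffeomorph hX hp hX' hA hf).symm) := by
  ext y
  exact ((Homeomorph.symm_apply_eq _).2
    (h.deformedHomeomorph_proj hX hp hs hd hX' hcomm hA hf hfμ y)).symm

include h hX hp hs hd hX' hcomm hA hf hfμ in
theorem isCoveringMap_deformedProj (hc : IsCoveringMap p) :
    IsCoveringMap (deformedProj p X' y₀ μ) := by
  rw [h.deformedProj_eq hX hp hs hd hX' hcomm hA hf hfμ]
  exact (hc.comp_homeomorph
    (h.shearDiffeomorph hX hp hX' hA hf).symm.toHomeomorph).homeomorph_comp _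

theorem isLocalDiffeomorph_deformedProj [ChartedSpace E (DeformedSpace p X' y₀ μ)]
    (he : (h.deformedHomeomorph hX hp hs hd hX' hcomm hA hf hfμ).PreservesCharts E) :
    IsLocalDiffeomorph 𝓘(ℝ, E) 𝓘(ℝ, E) ∞ (deformedProj p X' y₀ μ) := by
  intro y
  rw [h.deformedProj_eq hX hp hs hd hX' hcomm hA hf hfμ]
  have h1 := (h.shearDiffeomorph hX hp hX' hA hf).symm.isLocalDiffeomorph y
  have h2 := h1.comp _ _ (hp _)
  exact h2.comp _ _ (he.diffeomorph.symm.isLocalDiffeomorph _)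

end IsSmallCocycle

end DeformedHomeomorph

/-! ### Conjugate flows, orbit equivalence and periods -/

section Conjugation

variable {M N : Type*} [TopologicalSpace M] [TopologicalSpace N]

/-- The flow on `N` conjugate by a homeomorphism to a flow on `M`. -/
def Homeomorph.conjFlow (e : N ≃ₜ M) (Y : Flow ℝ M) : Flow ℝ N where
  toFun t n := e.symm (Y t (e n))
  cont' := e.symm.continuous.comp
    (Y.cont'.comp (continuous_fst.prodMk (e.continuous.comp continuous_snd)))
  map_zero' n := by simp
  map_add' s t n := by simp [Y.map_add]

theorem Homeomorph.conjFlow_apply (e : N ≃ₜ M) (Y : Flow ℝ M) (t : ℝ) (n : N) :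
    e.conjFlow Y t n = e.symm (Y t (e n)) := rfl

theorem Homeomorph.isPeriodOf_conjFlow (e : N ≃ₜ M) {Y : Flow ℝ M} {x : M} {T : ℝ}
    (h : IsPeriodOf Y x T) : IsPeriodOf (e.conjFlow Y) (e.symm x) T := by
  unfold IsPeriodOf at h ⊢
  simpa [e.conjFlow_apply] using h

end Conjugation

section TimeChange

variable {E : Type*} [NormedAddCommGroup E] [NormedSpace ℝ E]
  {M N : Type*} [TopologicalSpace M] [ChartedSpace E M] [TopologicalSpace N]

namespace IsSmallCocycle

variable {X : Flow ℝ M} {α : ∀ x : M, TangentSpace 𝓘(ℝ, E) x →L[ℝ] ℝ} {A : ℝ → M → ℝ}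
  (h : IsSmallCocycle X α A) (hX : IsSmoothFlow E X)

include h hX

theorem isOrbitEquivalence (e : N ≃ₜ M) :
    IsOrbitEquivalence X (e.conjFlow (h.flow hX)) e.symm := by
  intro x
  obtain ⟨τ, hτ⟩ := h.exists_orderIso hX x
  refine ⟨τ, by rw [hτ, h.zero, add_zero], fun t => ?_⟩
  rw [e.conjFlow_apply, e.apply_symm_apply, hτ, h.flow_add]

/-- The time change and `X` return to `x` at corresponding times, and the correspondence `s ↦ s + A
s x` is increasing and fixes `0`, so least positive return times correspond. -/
theorem isPeriodOf_flow {x : M} {T : ℝ} (hT : IsPeriodOf X x T) :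
    IsPeriodOf (h.flow hX) x (T + A T x) := by
  have h0 : (fun s => s + A s x) 0 = 0 := by simp [h.zero]
  refine ⟨⟨?_, by rw [h.flow_add, hT.1.2]⟩, ?_⟩
  · have := h.strictMono hX x hT.1.1
    rwa [h0] at this
  · rintro t ⟨ht, hx⟩
    have h1 := h.time_add hX t x
    have h2 : T ≤ h.time hX t x := by
      refine hT.2 ⟨(h.strictMono hX x).lt_iff_lt.1 ?_, hx⟩
      exact h0.trans_lt (ht.trans_eq h1.symm)
    exact ((h.strictMono hX x).monotone h2).trans_eq h1

theorem time_of_eq_zero (hA : ∀ s x, A s x = 0) (t : ℝ) (x : M) : h.time hX t x = t :=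
  h.time_eq hX (by rw [hA, add_zero])

end IsSmallCocycle

end TimeChange

/-! ### The deformation theorem -/

open IsEquivariantPartition in
theorem mainTheorem11
    {E : Type*} [NormedAddCommGroup E] [NormedSpace ℝ E] [FiniteDimensional ℝ E]
    {M : Type*} [TopologicalSpace M] [ChartedSpace E M] [IsManifold 𝓘(ℝ, E) ∞ M]
    [T2Space M] [CompactSpace M] [PathConnectedSpace M]
    {M' : Type*} [TopologicalSpace M'] [ChartedSpace E M'] [IsManifold 𝓘(ℝ, E) ∞ M']
    [PathConnectedSpace M']
    (X : Flow ℝ M) (hX : IsSmoothFlow E X)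
    (p : C(M', M)) (hp : IsUniversalAbelianCover E p)
    (X' : Flow ℝ M') (hX' : ∀ t y, p (X' t y) = X t (p y))
    (y₀ : M') :
    ∃ U : Set (FirstCohomology (p y₀)), IsOpen U ∧ 0 ∈ U ∧
    ∃ (_ : ∀ μ : U, ChartedSpace E (DeformedSpace p X' y₀ μ))
      (_ : ∀ μ : U, IsManifold 𝓘(ℝ, E) ∞ (DeformedSpace p X' y₀ μ))
      (Xd : ∀ μ : U, Flow ℝ (DeformedSpace p X' y₀ μ))
      (h : ∀ μ : U, M ≃ₘ^∞⟮𝓘(ℝ, E), 𝓘(ℝ, E)⟯ DeformedSpace p X' y₀ μ),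
      -- `M_μ` carries the smooth structure of the quotient, `X_μ^t` is induced by the lifted flow
      (∀ μ : U, IsCoveringMap (deformedProj p X' y₀ μ) ∧
        IsLocalDiffeomorph 𝓘(ℝ, E) 𝓘(ℝ, E) ∞ (deformedProj p X' y₀ μ)) ∧
      (∀ μ : U, IsSmoothFlow E (Xd μ) ∧
        ∀ t y, Xd μ t (deformedProj p X' y₀ μ y) = deformedProj p X' y₀ μ (X' t y)) ∧
      -- the flows, transported to `M` by `h_μ`, depend continuously on `μ`
      Continuous (fun q : U × ℝ × M => (h q.1).symm (Xd q.1 q.2.1 (h q.1 q.2.2))) ∧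
      -- `M_0 = M` (through the covering projection) and `X_0^t = X^t`
      (∀ μ : U, (μ : FirstCohomology (p y₀)) = 0 →
        (∀ y, h μ (p y) = deformedProj p X' y₀ μ y) ∧
        ∀ t x, h μ (X t x) = Xd μ t (h μ x)) ∧
      -- orbit equivalences
      (∀ μ : U, IsOrbitEquivalence X (Xd μ) (h μ)) ∧
      -- periods
      (∀ μ : U, ∀ (x : M) (T : ℝ) (hT : IsPeriodOf X x T),
        IsPeriodOf (Xd μ) (h μ x)
          (T + (μ : FirstCohomology (p y₀))
            (freeLoopClass (p y₀) (orbitLoop X x T hT.1.2)))) ∧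
      -- Anosov and contact flows
      (IsAnosovFlow E X → ∀ μ : U, IsAnosovFlow E (Xd μ)) ∧
      (IsContactFlow E X → ∀ μ : U, IsContactFlow E (Xd μ)) := by
  have hs := IsCoveringMap.surjective_of_pathConnected hp.isCoveringMap
  have : LocallyPathConnectedSpace M' := ChartedSpace.locallyPathConnectedSpace E M'
  have : CompleteSpace E := FiniteDimensional.complete ℝ E
  have hr := hp.range_map
  have hl := hp.isCoveringMap.isLocalHomeomorph
  have hd : ∀ y z : M', p y = p z → ∃ g : deckGroup p, g.1 y = z :=
    fun y z hyz => exists_deck hp.isCoveringMap hr hyz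
  have hcomm := deck_flow_comm hp.isCoveringMap hX'
  obtain ⟨t, ρ, c, h⟩ := exists_isEquivariantPartition (E := E) hp.isCoveringMap hr y₀
  let P : FirstCohomology (p y₀) × M → ℝ := fun q =>
    |formAt (closedForm (E := E) ρ c hs q.1) q.2 (flowVelocity E X q.2)|
  have hP : Continuous P := (h.continuous_closedForm_flowVelocity hs hd hl hX).abs
  let U : Set (FirstCohomology (p y₀)) := {μ | ∀ x, P (μ, x) < 1 / 2}
  have hU : IsOpen U := by
    -- The complement is the projection of a closed set along the compact factor `M`, hence closed.
    have h1 : Uᶜ = Prod.fst '' {q | 1 / 2 ≤ P q} := by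
      ext μ
      constructor
      · intro hμ
        obtain ⟨x, hx⟩ := not_forall.1 hμ
        exact ⟨(μ, x), not_lt.1 hx, rfl⟩
      · rintro ⟨⟨μ, x⟩, hx, rfl⟩ hμ
        exact not_le.2 (hμ x) hx
    rw [← isClosed_compl_iff, h1]
    exact isClosedMap_fst_of_compactSpace _ (isClosed_le continuous_const hP)
  have h0 : ∀ z, equivariantFun ρ c (0 : FirstCohomology (p y₀)) z = 0 := fun z => by
    simp [equivariantFun, FirstCohomology.zero_apply]
  have h0U : (0 : FirstCohomology (p y₀)) ∈ U := fun x => by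
    have h1 : localFun ρ c (0 : FirstCohomology (p y₀)) (Function.surjInv hs x)
        = fun _ : M => (0 : ℝ) := by
      ext
      simp [localFun, FirstCohomology.zero_apply]
    have h2 : formAt (closedForm (E := E) ρ c hs (0 : FirstCohomology (p y₀))) x = 0 := by
      unfold formAt closedForm differential
      rw [h1]
      exact mfderiv_const
    simp [P, h2]
  have hA := fun μ => h.cocycle_eq hs hd hcomm μ
  have hf := fun μ => h.contMDiff_equivariantFun hp.isLocalDiffeomorph.contMDiff μ
  have hdeck := fun μ => h.equivariantFun_deck μ
  have hS : ∀ μ : U, IsSmallCocycle X _ _ := fun μ => h.isSmallCocycle hs hd hl hX' hcomm μ.2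
  have hSs : ∀ μ : U, IsSmoothFlow E ((hS μ).flow hX) := fun μ => (hS μ).isSmoothFlow_flow hX
  have hYA : IsAnosovFlow E X → ∀ μ : U, IsAnosovFlow E ((hS μ).flow hX) :=
    fun hXA μ => ((hS μ).isTimeChange hX).isAnosovFlow hX (hSs μ) hXA
  have hYC : IsContactFlow E X → ∀ μ : U, IsContactFlow E ((hS μ).flow hX) :=
    fun hXC μ => ((hS μ).isTimeChange hX).isContactFlow hX (hSs μ) hXC
  let e : ∀ μ : U, DeformedSpace p X' y₀ μ ≃ₜ M := fun μ =>
    (hS μ).deformedHomeomorph hX hp.isLocalDiffeomorph hs hd hX' hcomm (hA μ) (hf μ) (hdeck μ)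
  let Y : U → Flow ℝ M := fun μ => (hS μ).flow hX
  let ch : ∀ μ : U, ChartedSpace E (DeformedSpace p X' y₀ μ) :=
    fun μ => (e μ).pullbackChartedSpace E
  have he : ∀ μ : U, (e μ).PreservesCharts E := fun μ _ => rfl
  have hman : ∀ μ : U, IsManifold 𝓘(ℝ, E) ∞ (DeformedSpace p X' y₀ μ) :=
    fun μ => (e μ).isManifold_pullback
  have hconj : ∀ (μ : U) (t : ℝ) (n : DeformedSpace p X' y₀ μ),
      e μ ((e μ).conjFlow (Y μ) t n) = Y μ t (e μ n) :=
    fun μ t n => (e μ).apply_symm_apply _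
  have hY : ∀ μ : U, IsSmoothFlow E (Y μ) := hSs
  refine ⟨U, hU, h0U, ch, hman, fun μ => (e μ).conjFlow (Y μ), fun μ => (he μ).diffeomorph.symm,
    fun μ => ⟨?_, ?_⟩, fun μ => ⟨(he μ).isSmoothFlow (hconj μ) (hY μ), fun t y => ?_⟩, ?_,
    fun μ hμ => ?_, fun μ => (hS μ).isOrbitEquivalence hX (e μ), fun μ x T hT => ?_,
    fun hXA μ => ?_, fun hXC μ => ?_⟩
  · exact (hS μ).isCoveringMap_deformedProj hX hp.isLocalDiffeomorph hs hd hX' hcomm (hA μ) (hf μ)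
      (hdeck μ) hp.isCoveringMap
  · exact (hS μ).isLocalDiffeomorph_deformedProj hX hp.isLocalDiffeomorph hs hd hX' hcomm (hA μ)
      (hf μ) (hdeck μ) (he μ)
  · refine (Homeomorph.symm_apply_eq (e μ)).2 ?_
    exact ((hS μ).unshear_flow hX hX' (hA μ) t y).symm
  · have hc : Continuous fun q : U × ℝ × M => ((q.1 : FirstCohomology (p y₀)), q.2) :=
      (continuous_subtype_val.comp continuous_fst).prodMk continuous_snd
    have hc' := IsSmallCocycle.continuous_flow_param hX hS
      ((h.continuous_cocycle hs hd hl hX' hcomm).comp hc)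
    refine hc'.congr fun q => ?_
    refine Eq.symm ?_
    change e q.1 ((e q.1).conjFlow (Y q.1) q.2.1 ((e q.1).symm q.2.2)) = _
    rw [hconj, Homeomorph.apply_symm_apply]
  · obtain ⟨μ, hμU⟩ := μ
    obtain rfl : μ = 0 := hμ
    -- For `μ = 0` the equivariant function vanishes, so neither the shear nor the change of time
    -- moves anything.
    have hA0 : ∀ s x, cocycle ρ c hs X' (0 : FirstCohomology (p y₀)) s x = 0 := fun s x => by
      simp [cocycle, h0]
    have htime := (hS ⟨0, hμU⟩).time_of_eq_zero hX hA0
    refine ⟨fun y => (Homeomorph.symm_apply_eq (e ⟨0, hμU⟩)).2 ?_, fun t x => ?_⟩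
    · change p y = p (X' ((hS ⟨0, hμU⟩).time hX (-equivariantFun ρ c 0 y) (p y)) y)
      rw [htime, h0, neg_zero, X'.map_zero_apply]
    · change (e ⟨0, hμU⟩).symm (X t x) = (e ⟨0, hμU⟩).symm
        (X ((hS ⟨0, hμU⟩).time hX t (e ⟨0, hμU⟩ ((e ⟨0, hμU⟩).symm x)))
          (e ⟨0, hμU⟩ ((e ⟨0, hμU⟩).symm x)))
      rw [htime, Homeomorph.apply_symm_apply]
  · obtain ⟨z, rfl⟩ := hs x
    -- A lift of the closed orbit ends at a translate `g z` of its start, so `A T x = f (g z) - f z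
    -- = μ(g)`, and the class of `g` is that of the orbit.
    obtain ⟨g, hg⟩ := hd z (X' T z) (by rw [hX', hT.1.2])
    have h1 := hA μ T z
    rw [← hg, hdeck, add_sub_cancel_left,
      ← freeLoopClass_orbitLoop hr hX' y₀ g hg.symm hT.1.2] at h1
    have h2 := (e μ).isPeriodOf_conjFlow ((hS μ).isPeriodOf_flow hX hT)
    rw [h1] at h2
    exact h2
  · exact (he μ).isAnosovFlow (hconj μ) (hY μ) (hYA hXA μ)
  · exact (he μ).isContactFlow (hconj μ) (hY μ) (hYC hXC μ)
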